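/- There is a constant $K>0$ such that for every integer $n\ge 2$, every $0<\varepsilon\le 1/2$ and every $U\in U(2)$ there is a quantum circuit on $n+1$ qubits (the $n$ control qubits and the target qubit, with no auxiliary qubits), composed of arbitrary single-qubit unitary gates and CNOT gates, whose unitary operator $\widetilde U$ satisfies $\|\widetilde U-C^nU\|\le\varepsilon$ and whose depth is at most $K\,(\log n)^{2.799}\,\log(1/\varepsilon)$. Here $C^nU$ is the $n$-controlled $U$ gate, which applies $U$ to the target if all $n$ controls are in state $|1\rangle$ and acts as the identity otherwise; $\|\cdot\|$ is the operator norm induced by the Euclidean norm; and the depth is the number of layers of gates, where the gates in one layer act on pairwise disjoint sets of qubits. -/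

import Mathlib

-- The norm on complex matrices is the operator norm induced by the Euclidean norm.
open scoped Matrix.Norms.L2Operator

namespace QuantumCircuit

/-- Operators on the qubits labelled by `Q`, as matrices in the computational basis. A basis
state is a bit string `Q → Fin 2`. -/
abbrev Operator (Q : Type*) : Type _ := Matrix (Q → Fin 2) (Q → Fin 2) ℂ

/-- The Pauli matrix `X`, the NOT gate. -/
def pauliX : Matrix (Fin 2) (Fin 2) ℂ := !![0, 1; 1, 0]

/-- The gate which applies the one-qubit operator `U` to the qubit `t` if all qubits in `S` are in
the state `1`, applies the identity otherwise, and leaves the qubits other than `t` unchanged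
(used with `t ∉ S`). -/
def controlled {Q : Type*} [Fintype Q] [DecidableEq Q] (S : Finset Q) (t : Q)
    (U : Matrix (Fin 2) (Fin 2) ℂ) : Operator Q :=
  Matrix.of fun x y =>
    if ∀ i, i ≠ t → x i = y i then
      (if ∀ i ∈ S, y i = 1 then U (x t) (y t) else (1 : Matrix (Fin 2) (Fin 2) ℂ) (x t) (y t))
    else 0

/-- The `n`-controlled `U` gate on `n + 1` qubits: the last qubit is the target, all the other
qubits are controls. -/
def multiControlled (n : ℕ) (U : Matrix (Fin 2) (Fin 2) ℂ) : Operator (Fin (n + 1)) :=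
  controlled (Finset.univ.erase (Fin.last n)) (Fin.last n) U

/-- The elementary gates: arbitrary one-qubit gates and CNOT gates. -/
inductive Gate (Q : Type*) : Type _
  | single (t : Q) (U : Matrix.unitaryGroup (Fin 2) ℂ) : Gate Q
  | cnot (c t : Q) (hct : c ≠ t) : Gate Q

/-- The set of qubits on which an elementary gate acts. -/
def Gate.support {Q : Type*} [DecidableEq Q] : Gate Q → Finset Q
  | .single t _ => {t}
  | .cnot c t _ => {c, t}

/-- The operator of an elementary gate on the whole register. -/
def Gate.toOperator {Q : Type*} [Fintype Q] [DecidableEq Q] : Gate Q → Operator Q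
  | .single t U => controlled ∅ t U.1
  | .cnot c t _ => controlled {c} t pauliX

/-- A layer: elementary gates on pairwise disjoint sets of qubits, executed in parallel. -/
structure Layer (Q : Type*) [DecidableEq Q] where
  gates : List (Gate Q)
  disjoint : gates.Pairwise fun g h => Disjoint g.support h.support

/-- The operator of a layer. The gates of a layer commute, so their order does not matter. -/
def Layer.toOperator {Q : Type*} [Fintype Q] [DecidableEq Q] (L : Layer Q) : Operator Q :=
  (L.gates.map Gate.toOperator).prod

/-- A circuit on the qubits `Q`: a finite sequence of layers, the first one being executed
first. -/
structure Circuit (Q : Type*) [DecidableEq Q] where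
  layers : List (Layer Q)

/-- The operator implemented by a circuit: layers executed later multiply from the left. -/
def Circuit.toOperator {Q : Type*} [Fintype Q] [DecidableEq Q] (c : Circuit Q) : Operator Q :=
  (c.layers.reverse.map Layer.toOperator).prod

/-- The depth of a circuit: its number of layers. -/
def Circuit.depth {Q : Type*} [DecidableEq Q] (c : Circuit Q) : ℕ := c.layers.length

end QuantumCircuit

/-! ### Controlled gates as operators on states. -/

namespace QuantumCircuit

open Function Matrix

variable {Q : Type*} [DecidableEq Q]

/-! The construction has depth O((log n)² log(1/ε)); since log n ≥ log 2, the exponent 2 may be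
raised to 2.799 at the price of a constant.

Diagonalizing U (`unitary_diagonalization`) reduces the gate to one that multiplies basis states by
phases. Circuits then become bookkeeping of angle functions: successive phases add, and conjugating
by a permutation of basis states precomposes. The identity `ctrlAngle_insert` removes one control c,
halving the angles and spending two NOTs on c controlled by the remaining controls. After k steps
the leftover angles are at most π/2^k and the leftover gate is dropped, so about log₂(1/ε) + 2 steps
suffice, whatever n is.

What remains is a multi-controlled NOT in depth O((log n)²) without auxiliary qubits
(`realizes_toggle`). An idle qubit in an unknown state can be borrowed (`borrowed_toggle`). Two
controls y, z are split off; if both are 1, flipping them gives two zeroed bits, which a tree of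
Toffoli gates uses to conjoin further controls (`exists_conjunction_tree`). If that conjunction is
true, every bit of the tree except its root is 0 again, so the workspace doubles in each round
(`exists_conjunction_chunks`). Logarithmically many rounds of logarithmic depth leave O(log n)
roots, for which a quadratic-depth gate (`realizes_toggle_quadratic`) is cheap enough. If y or z is
0 the computation is junk, but it is run and undone so that its effect cancels. -/

theorem agree_off_iff {t : Q} {x y : Q → Fin 2} :
    (∀ i, i ≠ t → x i = y i) ↔ y = update x t (y t) := by
  constructor
  · intro h
    funext i
    by_cases hi : i = t
    · subst hi; simp
    · simp [hi, h i hi]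
  · intro h i hi
    rw [h]; simp [hi]

theorem one_apply_update (ψ : (Q → Fin 2) → ℂ) (x : Q → Fin 2) (t : Q) :
    (1 : Matrix (Fin 2) (Fin 2) ℂ) (x t) 0 * ψ (update x t 0) +
      (1 : Matrix (Fin 2) (Fin 2) ℂ) (x t) 1 * ψ (update x t 1) = ψ x := by
  conv_rhs => rw [← update_eq_self t x]
  generalize x t = b
  revert b
  rw [Fin.forall_fin_two]
  simp

/-- The inverse of an elementary gate. -/
def Gate.inv : Gate Q → Gate Q
  | .single t U => .single t U⁻¹
  | .cnot c t h => .cnot c t h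

theorem Gate.inv_support (g : Gate Q) : g.inv.support = g.support := by cases g <;> rfl

variable [Fintype Q]

/-- The action of a controlled gate on a state vector. -/
theorem controlled_mulVec {S : Finset Q} {t : Q} (ht : t ∉ S) (U : Matrix (Fin 2) (Fin 2) ℂ)
    (ψ : (Q → Fin 2) → ℂ) (x : Q → Fin 2) :
    (controlled S t U *ᵥ ψ) x =
      if ∀ i ∈ S, x i = 1 then U (x t) 0 * ψ (update x t 0) + U (x t) 1 * ψ (update x t 1)
      else ψ x := by
  have hne : update x t (0 : Fin 2) ≠ update x t 1 := fun h => by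
    simpa using congrFun h t
  have key : ∀ b : Fin 2, controlled S t U x (update x t b) =
      if ∀ i ∈ S, x i = 1 then U (x t) b else (1 : Matrix (Fin 2) (Fin 2) ℂ) (x t) b := by
    intro b
    have h1 : ∀ i, i ≠ t → x i = update x t b i := fun i hi => by simp [hi]
    have h2 : (∀ i ∈ S, update x t b i = 1) ↔ ∀ i ∈ S, x i = 1 := by
      refine forall₂_congr fun i hi => ?_
      have : i ≠ t := fun h => ht (h ▸ hi)
      simp [this]
    rw [controlled, Matrix.of_apply, if_pos h1, update_self]
    simp only [h2]
  have hz : ∀ y, y ∉ ({update x t 0, update x t 1} : Finset (Q → Fin 2)) →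
      controlled S t U x y * ψ y = 0 := by
    intro y hy
    have : ¬ ∀ i, i ≠ t → x i = y i := by
      rw [agree_off_iff]
      intro h
      apply hy
      rw [h]
      rcases Fin.exists_fin_two.1 ⟨y t, rfl⟩ with h0 | h0 <;> simp [← h0]
    simp [controlled, this]
  rw [Matrix.mulVec, dotProduct, ← Finset.sum_subset (Finset.subset_univ _)
    (fun y _ hy => hz y hy), Finset.sum_pair hne, key, key]
  split_ifs with h
  · rfl
  · exact one_apply_update ψ x t

theorem operator_ext {M N : Operator Q} (h : ∀ ψ x, (M *ᵥ ψ) x = (N *ᵥ ψ) x) : M = N :=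
  Matrix.ext_of_mulVec_single fun _ => funext (h _)

theorem controlled_one {S : Finset Q} {t : Q} (ht : t ∉ S) : controlled S t 1 = 1 := by
  refine operator_ext fun ψ x => ?_
  rw [controlled_mulVec ht, Matrix.one_mulVec]
  split_ifs
  · exact one_apply_update ψ x t
  · rfl

theorem controlled_mul {S : Finset Q} {t : Q} (ht : t ∉ S) (U V : Matrix (Fin 2) (Fin 2) ℂ) :
    controlled S t U * controlled S t V = controlled S t (U * V) := by
  refine operator_ext fun ψ x => ?_
  have h : ∀ b, (∀ i ∈ S, update x t b i = 1) ↔ ∀ i ∈ S, x i = 1 := fun b =>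
    forall₂_congr fun i hi => by
      have : i ≠ t := fun h => ht (h ▸ hi)
      simp [this]
  rw [← Matrix.mulVec_mulVec]
  simp only [controlled_mulVec ht, h, update_self, update_idem]
  split_ifs
  · simp only [Matrix.mul_apply, Fin.sum_univ_two]; ring
  · rfl

/-- If some control is 0, the middle gate is idle and the outer pair cancels. Hence a change of
basis on the target needs no controls. -/
theorem controlled_conj {S : Finset Q} {t : Q} (ht : t ∉ S) {W W' : Matrix (Fin 2) (Fin 2) ℂ}
    (hW : W * W' = 1) (D : Matrix (Fin 2) (Fin 2) ℂ) :
    controlled ∅ t W * controlled S t D * controlled ∅ t W' = controlled S t (W * D * W') := by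
  refine operator_ext fun ψ x => ?_
  have h : ∀ b, (∀ i ∈ S, update x t b i = 1) ↔ ∀ i ∈ S, x i = 1 := fun b =>
    forall₂_congr fun i hi => by
      have : i ≠ t := fun h => ht (h ▸ hi)
      simp [this]
  by_cases hS : ∀ i ∈ S, x i = 1
  · rw [← Matrix.mulVec_mulVec, ← Matrix.mulVec_mulVec]
    simp only [controlled_mulVec ht, controlled_mulVec (Finset.notMem_empty t), h, update_self,
      update_idem, if_pos hS, Finset.notMem_empty, false_imp_iff, implies_true, if_true,
      Matrix.mul_apply, Fin.sum_univ_two]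
    ring
  · have e : (controlled ∅ t W *ᵥ controlled ∅ t W' *ᵥ ψ) x = ψ x := by
      rw [Matrix.mulVec_mulVec, controlled_mul (by simp), hW, controlled_one (by simp),
        Matrix.one_mulVec]
    rw [← Matrix.mulVec_mulVec, ← Matrix.mulVec_mulVec, controlled_mulVec ht, if_neg hS, ← e]
    simp only [controlled_mulVec ht, controlled_mulVec (Finset.notMem_empty t), h, update_self,
      update_idem, if_neg hS]

theorem controlled_conjTranspose {S : Finset Q} {t : Q} (ht : t ∉ S)
    (U : Matrix (Fin 2) (Fin 2) ℂ) : (controlled S t U)ᴴ = controlled S t Uᴴ := by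
  ext x y
  simp only [controlled, Matrix.conjTranspose_apply, Matrix.of_apply]
  by_cases h : ∀ i, i ≠ t → x i = y i
  · have h' : ∀ i, i ≠ t → y i = x i := fun i hi => (h i hi).symm
    have h2 : (∀ i ∈ S, x i = 1) ↔ ∀ i ∈ S, y i = 1 :=
      forall₂_congr fun i hi => by rw [h i fun h => ht (h ▸ hi)]
    rw [if_pos h, if_pos h']
    simp only [h2]
    split_ifs
    · rfl
    · rw [← Matrix.conjTranspose_apply, Matrix.conjTranspose_one]
  · have h' : ¬ ∀ i, i ≠ t → y i = x i := fun H => h fun i hi => (H i hi).symm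
    rw [if_neg h, if_neg h', star_zero]

theorem controlled_commute {S S' : Finset Q} {t t' : Q} (ht : t ∉ S) (ht' : t' ∉ S')
    (h : Disjoint (insert t S) (insert t' S')) (U V : Matrix (Fin 2) (Fin 2) ℂ) :
    Commute (controlled S t U) (controlled S' t' V) := by
  have hne : t ≠ t' := fun e => by subst e; simp at h
  have hS : t' ∉ S := fun e => Finset.disjoint_left.1 h (Finset.mem_insert_of_mem e) (by simp)
  have hS' : t ∉ S' := fun e => Finset.disjoint_left.1 h (by simp) (Finset.mem_insert_of_mem e)
  refine operator_ext fun ψ x => ?_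
  have h1 : ∀ b, (∀ i ∈ S, update x t' b i = 1) ↔ ∀ i ∈ S, x i = 1 := fun b =>
    forall₂_congr fun i hi => by
      have : i ≠ t' := fun h => hS (h ▸ hi)
      simp [this]
  have h2 : ∀ b, (∀ i ∈ S', update x t b i = 1) ↔ ∀ i ∈ S', x i = 1 := fun b =>
    forall₂_congr fun i hi => by
      have : i ≠ t := fun h => hS' (h ▸ hi)
      simp [this]
  rw [← Matrix.mulVec_mulVec, ← Matrix.mulVec_mulVec]
  simp only [controlled_mulVec ht, controlled_mulVec ht', h1, h2, update_of_ne hne,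
    update_of_ne hne.symm, update_comm hne]
  split_ifs <;> ring

theorem Gate.commute {g h : Gate Q} (hgh : Disjoint g.support h.support) :
    Commute g.toOperator h.toOperator := by
  cases g with
  | single t U =>
    cases h with
    | single t' U' => exact controlled_commute (by simp) (by simp) hgh _ _
    | cnot c t' hc =>
      refine controlled_commute (by simp) (by simpa using hc.symm) ?_ _ _
      rw [Finset.pair_comm]; exact hgh
  | cnot c t hct =>
    cases h with
    | single t' U' =>
      refine controlled_commute (by simpa using hct.symm) (by simp) ?_ _ _
      rw [Finset.pair_comm]; exact hgh
    | cnot c' t' hc =>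
      refine controlled_commute (by simpa using hct.symm) (by simpa using hc.symm) ?_ _ _
      rw [Finset.pair_comm, Finset.pair_comm t']; exact hgh

/-! ### Depth of implementations: composition, inverses, parallel execution. -/

/-- All gates of a list of layers act on qubits in `A`. -/
def SupportedOn (A : Finset Q) (l : List (Layer Q)) : Prop :=
  ∀ L ∈ l, ∀ g ∈ L.gates, g.support ⊆ A

/-- The operator of a list of layers. -/
def layersOp (l : List (Layer Q)) : Operator Q := (l.reverse.map Layer.toOperator).prod

theorem layersOp_nil : layersOp ([] : List (Layer Q)) = 1 := rfl

theorem layersOp_cons (L : Layer Q) (l : List (Layer Q)) :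
    layersOp (L :: l) = layersOp l * L.toOperator := by
  simp [layersOp]

theorem layersOp_append (l l' : List (Layer Q)) :
    layersOp (l ++ l') = layersOp l' * layersOp l := by
  simp [layersOp]

/-- The operator `M` is implemented exactly by a circuit of depth at most `d` whose gates all act
inside `A`. -/
def Implements (A : Finset Q) (d : ℕ) (M : Operator Q) : Prop :=
  ∃ l : List (Layer Q), SupportedOn A l ∧ l.length ≤ d ∧ layersOp l = M

theorem Implements.mono {A B : Finset Q} {d e : ℕ} {M : Operator Q} (h : Implements A d M)
    (hAB : A ⊆ B) (hde : d ≤ e) : Implements B e M := by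
  obtain ⟨l, h1, h2, h3⟩ := h
  exact ⟨l, fun L hL g hg => (h1 L hL g hg).trans hAB, h2.trans hde, h3⟩

theorem Implements.one (A : Finset Q) (d : ℕ) : Implements A d 1 :=
  ⟨[], by simp [SupportedOn], by simp, rfl⟩

/-- First `N`, then `M`. -/
theorem Implements.mul {A : Finset Q} {d e : ℕ} {M N : Operator Q} (hM : Implements A d M)
    (hN : Implements A e N) : Implements A (e + d) (M * N) := by
  obtain ⟨l, h1, h2, h3⟩ := hM
  obtain ⟨l', h1', h2', h3'⟩ := hN
  refine ⟨l' ++ l, ?_, by simp; omega, by rw [layersOp_append, h3, h3']⟩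
  intro L hL
  rcases List.mem_append.1 hL with h | h
  · exact h1' L h
  · exact h1 L h

theorem Implements.gate (g : Gate Q) : Implements g.support 1 g.toOperator :=
  ⟨[⟨[g], by simp⟩], by simp [SupportedOn], by simp, by simp [layersOp, Layer.toOperator]⟩

theorem pauliX_conjTranspose : pauliXᴴ = pauliX := by
  ext i j; fin_cases i <;> fin_cases j <;> simp [pauliX]

theorem Gate.inv_toOperator (g : Gate Q) : g.inv.toOperator = g.toOperatorᴴ := by
  cases g with
  | single t U => exact (controlled_conjTranspose (by simp) _).symm
  | cnot c t h =>
    have := controlled_conjTranspose (S := {c}) (t := t) (by simpa using h.symm) pauliX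
    rw [pauliX_conjTranspose] at this
    exact this.symm

/-- Reversing the layers and inverting each gate keeps the depth, so undoing a computation costs as
much as doing it. -/
theorem Implements.conjTranspose {A : Finset Q} {d : ℕ} {M : Operator Q} (h : Implements A d M) :
    Implements A d Mᴴ := by
  obtain ⟨l, h1, h2, rfl⟩ := h
  have key : ∀ L : Layer Q, ∃ L' : Layer Q,
      (∀ g ∈ L'.gates, ∃ g' ∈ L.gates, g.support = g'.support) ∧
        L'.toOperator = L.toOperatorᴴ := by
    intro L
    refine ⟨⟨(L.gates.map Gate.inv).reverse, ?_⟩, ?_, ?_⟩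
    · rw [List.pairwise_reverse, List.pairwise_map]
      exact L.disjoint.imp fun h => by simpa only [Gate.inv_support] using h.symm
    · intro g hg
      simp only [List.mem_reverse, List.mem_map] at hg
      obtain ⟨g', hg', rfl⟩ := hg
      exact ⟨g', hg', Gate.inv_support g'⟩
    · simp only [Layer.toOperator]
      rw [Matrix.conjTranspose_list_prod, List.map_map, List.map_reverse, List.map_map]
      congr 2
      refine List.map_congr_left fun g _ => ?_
      exact Gate.inv_toOperator g
  choose f hf hf' using key
  refine ⟨(l.map f).reverse, ?_, by simpa using h2, ?_⟩
  · intro L hL g hg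
    simp only [List.mem_reverse, List.mem_map] at hL
    obtain ⟨L', hL', rfl⟩ := hL
    obtain ⟨g', hg', e⟩ := hf L' g hg
    rw [e]; exact h1 L' hL' g' hg'
  · simp only [layersOp]
    rw [Matrix.conjTranspose_list_prod, List.reverse_reverse, List.map_map, List.map_map,
      List.map_reverse, List.reverse_reverse]
    congr 1
    exact List.map_congr_left fun L _ => hf' L

theorem Layer.commute {A B : Finset Q} (hAB : Disjoint A B) {L L' : Layer Q}
    (hL : ∀ g ∈ L.gates, g.support ⊆ A) (hL' : ∀ g ∈ L'.gates, g.support ⊆ B) :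
    Commute L.toOperator L'.toOperator := by
  refine Commute.list_prod_left _ _ fun M hM => Commute.list_prod_right _ _ fun N hN => ?_
  obtain ⟨g, hg, rfl⟩ := List.mem_map.1 hM
  obtain ⟨h, hh, rfl⟩ := List.mem_map.1 hN
  exact Gate.commute (hAB.mono (hL g hg) (hL' h hh))

theorem layersOp_commute {A B : Finset Q} (hAB : Disjoint A B) {l l' : List (Layer Q)}
    (hl : SupportedOn A l) (hl' : SupportedOn B l') : Commute (layersOp l) (layersOp l') := by
  refine Commute.list_prod_left _ _ fun M hM => Commute.list_prod_right _ _ fun N hN => ?_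
  obtain ⟨L, hL, rfl⟩ := List.mem_map.1 hM
  obtain ⟨L', hL', rfl⟩ := List.mem_map.1 hN
  exact Layer.commute hAB (hl L (by simpa using hL)) (hl' L' (by simpa using hL'))

/-- Layers are merged pairwise from the front. This is sound because the tail of the second circuit
commutes with the head of the first, their supports being disjoint. -/
theorem exists_parallel {A B : Finset Q} (hAB : Disjoint A B) :
    ∀ l l' : List (Layer Q), SupportedOn A l → SupportedOn B l' →
      ∃ m : List (Layer Q), SupportedOn (A ∪ B) m ∧ m.length ≤ max l.length l'.length ∧
        layersOp m = layersOp l * layersOp l'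
  | [], l', _, h' => ⟨l', fun L hL g hg => (h' L hL g hg).trans Finset.subset_union_right,
      by simp, by simp [layersOp_nil]⟩
  | L :: l, [], h, _ => ⟨L :: l, fun L hL g hg => (h L hL g hg).trans Finset.subset_union_left,
      by simp, by simp [layersOp_nil]⟩
  | L :: l, L' :: l', h, h' => by
    have hL : ∀ g ∈ L.gates, g.support ⊆ A := h L (by simp)
    have hL' : ∀ g ∈ L'.gates, g.support ⊆ B := h' L' (by simp)
    have hl : SupportedOn A l := fun K hK => h K (by simp [hK])
    have hl' : SupportedOn B l' := fun K hK => h' K (by simp [hK])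
    obtain ⟨m, m1, m2, m3⟩ := exists_parallel hAB l l' hl hl'
    refine ⟨⟨L.gates ++ L'.gates, List.pairwise_append.2 ⟨L.disjoint, L'.disjoint,
      fun g hg g' hg' => hAB.mono (hL g hg) (hL' g' hg')⟩⟩ :: m, ?_, ?_, ?_⟩
    · intro K hK g hg
      rcases List.mem_cons.1 hK with rfl | hK
      · rcases List.mem_append.1 hg with hg | hg
        · exact (hL g hg).trans Finset.subset_union_left
        · exact (hL' g hg).trans Finset.subset_union_right
      · exact m1 K hK g hg
    · simp only [List.length_cons]; omega
    · have c : Commute (layersOp l') L.toOperator := by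
        have := layersOp_commute hAB (l := [L]) (l' := l') (by simpa [SupportedOn] using hL) hl'
        simpa [layersOp] using this.symm
      have e : Layer.toOperator ⟨L.gates ++ L'.gates, List.pairwise_append.2 ⟨L.disjoint,
          L'.disjoint, fun g hg g' hg' => hAB.mono (hL g hg) (hL' g' hg')⟩⟩ =
            L.toOperator * L'.toOperator := by
        simp [Layer.toOperator]
      rw [layersOp_cons, layersOp_cons, layersOp_cons, m3, e, mul_assoc, mul_assoc,
        ← mul_assoc (layersOp l'), c.eq, mul_assoc]

theorem Implements.parallel {A B : Finset Q} (hAB : Disjoint A B) {d : ℕ} {M N : Operator Q}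
    (hM : Implements A d M) (hN : Implements B d N) : Implements (A ∪ B) d (M * N) := by
  obtain ⟨l, h1, h2, rfl⟩ := hM
  obtain ⟨l', h1', h2', rfl⟩ := hN
  obtain ⟨m, m1, m2, m3⟩ := exists_parallel hAB l l' h1 h1'
  exact ⟨m, m1, m2.trans (max_le h2 h2'), m3⟩

end QuantumCircuit

namespace QuantumCircuit

open Function Matrix

/-! ### Diagonalization of one-qubit unitaries. -/

section Diagonalization

theorem exists_unitary_first_column {p q : ℂ} (h : ¬ (p = 0 ∧ q = 0)) :
    ∃ W : Matrix.unitaryGroup (Fin 2) ℂ, ∃ r : ℂ, r ≠ 0 ∧ W.1 0 0 = r * p ∧ W.1 1 0 = r * q := by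
  set N : ℝ := Complex.normSq p + Complex.normSq q with hN
  have hpos : 0 < N := by
    rcases not_and_or.1 h with h | h
    · exact add_pos_of_pos_of_nonneg (Complex.normSq_pos.2 h) (Complex.normSq_nonneg _)
    · exact add_pos_of_nonneg_of_pos (Complex.normSq_nonneg _) (Complex.normSq_pos.2 h)
  set s : ℝ := (Real.sqrt N)⁻¹ with hs
  have hs2 : s * s * N = 1 := by
    rw [hs, ← mul_inv, Real.mul_self_sqrt hpos.le, inv_mul_cancel₀ hpos.ne']
  have hs2' : (s : ℂ) * s * (p * (starRingEnd ℂ) p + q * (starRingEnd ℂ) q) = 1 := by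
    have : p * (starRingEnd ℂ) p + q * (starRingEnd ℂ) q = (N : ℂ) := by
      rw [hN]; push_cast; rw [← Complex.mul_conj, ← Complex.mul_conj]
    rw [this]; exact_mod_cast hs2
  refine ⟨⟨!![s * p, -(s * star q); s * q, s * star p], ?_⟩, s, ?_, rfl, rfl⟩
  · rw [Matrix.mem_unitaryGroup_iff']
    ext i j
    fin_cases i <;> fin_cases j <;>
      simp [Matrix.mul_apply, Fin.sum_univ_two, Matrix.star_apply] <;>
      first
      | linear_combination hs2'
      | ring
  · have : s ≠ 0 := inv_ne_zero (Real.sqrt_pos.2 hpos).ne'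
    exact_mod_cast this

/-- The diagonal unitary with the phases `α` and `β`. -/
noncomputable def diagPhase (α β : ℝ) : Matrix (Fin 2) (Fin 2) ℂ :=
  !![Complex.exp (Complex.I * α), 0; 0, Complex.exp (Complex.I * β)]

theorem diagPhase_mem (α β : ℝ) : diagPhase α β ∈ Matrix.unitaryGroup (Fin 2) ℂ := by
  have key : ∀ a : ℝ, (starRingEnd ℂ) (Complex.exp (Complex.I * a)) *
      Complex.exp (Complex.I * a) = 1 := fun a => by
    rw [← Complex.exp_conj, ← Complex.exp_add]; simp
  rw [Matrix.mem_unitaryGroup_iff']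
  ext i j
  fin_cases i <;> fin_cases j <;>
    simp [diagPhase, Matrix.mul_apply, Fin.sum_univ_two, Matrix.star_apply, key]

theorem exists_exp_of_mul_star {z : ℂ} (h : z * star z = 1) :
    ∃ a : ℝ, |a| ≤ Real.pi ∧ z = Complex.exp (Complex.I * a) := by
  refine ⟨z.arg, Complex.abs_arg_le_pi z, ?_⟩
  have h1 : ‖z‖ = 1 := by
    have : (‖z‖ : ℂ) ^ 2 = 1 := by rw [← Complex.mul_conj']; exact h
    have h2 : ‖z‖ ^ 2 = 1 := by exact_mod_cast this
    exact (pow_eq_one_iff_of_nonneg (norm_nonneg z) two_ne_zero).1 h2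
  have := Complex.norm_mul_exp_arg_mul_I z
  rw [h1, Complex.ofReal_one, one_mul, mul_comm] at this
  exact this.symm

/-- With a normalized eigenvector as first column of W, the matrix W⁻¹UW is upper triangular;
orthogonality of its rows kills the other off-diagonal entry. The bound π is where the halving of
angles starts. -/
theorem unitary_diagonalization (U : Matrix.unitaryGroup (Fin 2) ℂ) :
    ∃ W : Matrix.unitaryGroup (Fin 2) ℂ, ∃ α β : ℝ, |α| ≤ Real.pi ∧ |β| ≤ Real.pi ∧
      U.1 = W.1 * diagPhase α β * (W⁻¹).1 := by
  obtain ⟨μ, hμ⟩ := Module.End.exists_eigenvalue (Matrix.toLin' U.1)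
  obtain ⟨v, hv⟩ := hμ.exists_hasEigenvector
  have hUv : U.1 *ᵥ v = μ • v := by
    have := hv.apply_eq_smul
    rwa [Matrix.toLin'_apply] at this
  have hv0 : ¬ (v 0 = 0 ∧ v 1 = 0) := by
    rintro ⟨h0, h1⟩
    apply hv.2
    funext i
    fin_cases i
    · exact h0
    · exact h1
  obtain ⟨W, r, hr, hW0, hW1⟩ := exists_unitary_first_column hv0
  set T : Matrix.unitaryGroup (Fin 2) ℂ := W⁻¹ * U * W with hT
  have hTW : W.1 * T.1 = U.1 * W.1 := by
    have : W * T = U * W := by rw [hT]; group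
    exact congrArg Subtype.val this
  have hT0 : T.1 1 0 = 0 := by
    have e0 : W.1 *ᵥ (Pi.single 0 1) = r • v := by
      funext i
      rw [Matrix.mulVec_single_one]
      fin_cases i
      · exact hW0
      · exact hW1
    have e1 : W.1 *ᵥ (T.1 *ᵥ Pi.single 0 1) = W.1 *ᵥ (μ • Pi.single 0 1) := by
      rw [Matrix.mulVec_mulVec, hTW, ← Matrix.mulVec_mulVec, e0, Matrix.mulVec_smul,
        Matrix.mulVec_smul, hUv, e0, smul_comm]
    have e2 : T.1 *ᵥ Pi.single 0 1 = μ • Pi.single 0 1 := by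
      have h := congrArg (fun w => (W⁻¹).1 *ᵥ w) e1
      have h1 : (W⁻¹).1 * W.1 = 1 := congrArg Subtype.val (inv_mul_cancel W)
      simpa only [Matrix.mulVec_mulVec, ← mul_assoc, h1, Matrix.one_mulVec, one_mul] using h
    have := congrFun e2 1
    rw [Matrix.mulVec_single_one] at this
    simpa using this
  have hTT : T.1 * star T.1 = 1 := Matrix.mem_unitaryGroup_iff.1 T.2
  have h01 := congrFun (congrFun hTT 0) 1
  have h11 := congrFun (congrFun hTT 1) 1
  have h00 := congrFun (congrFun hTT 0) 0
  simp only [Matrix.mul_apply, Fin.sum_univ_two, Matrix.star_apply, hT0, star_zero, mul_zero,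
    zero_add, Matrix.one_apply_eq] at h01 h11 h00
  have hT1 : T.1 0 1 = 0 := by
    have : T.1 0 1 * star (T.1 1 1) = 0 := by simpa using h01
    rcases mul_eq_zero.1 this with h | h
    · exact h
    · rw [h, mul_zero] at h11; exact absurd h11 zero_ne_one
  rw [hT1, zero_mul, add_zero] at h00
  obtain ⟨α, hα, eα⟩ := exists_exp_of_mul_star h00
  obtain ⟨β, hβ, eβ⟩ := exists_exp_of_mul_star h11
  refine ⟨W, α, β, hα, hβ, ?_⟩
  have hTd : T.1 = diagPhase α β := by
    ext i j
    fin_cases i <;> fin_cases j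
    · exact eα
    · exact hT1
    · exact hT0
    · exact eβ
  have : U = W * T * W⁻¹ := by rw [hT]; group
  rw [← hTd]
  exact congrArg Subtype.val this

end Diagonalization

/-! ### Permutations of basis states, diagonal phases and the removal of one control. -/

section Permutations

variable {Q : Type*} [DecidableEq Q]

theorem fin_two_add_one_add_one (b : Fin 2) : b + 1 + 1 = b := by
  revert b; decide

/-- The permutation of the bit strings which flips the bit `t` if all other bits in `S` are `1`. -/
def toggle (S : Finset Q) (t : Q) : Equiv.Perm (Q → Fin 2) :=
  Function.Involutive.toPerm
    -- The clause `i ≠ t` makes this an involution for all S and t, with no side condition.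
    (fun x => if ∀ i ∈ S, i ≠ t → x i = 1 then update x t (x t + 1) else x) (by
      intro x
      have h : (∀ i ∈ S, i ≠ t → update x t (x t + 1) i = 1) ↔ ∀ i ∈ S, i ≠ t → x i = 1 :=
        forall₃_congr fun i _ hi => by simp [hi]
      by_cases hx : ∀ i ∈ S, i ≠ t → x i = 1
      · simp only [if_pos hx, if_pos (h.2 hx), update_self, update_idem, fin_two_add_one_add_one,
          update_eq_self]
      · simp only [if_neg hx])

theorem toggle_apply_ite (S : Finset Q) (t : Q) (x : Q → Fin 2) :
    toggle S t x = if ∀ i ∈ S, i ≠ t → x i = 1 then update x t (x t + 1) else x := rfl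

theorem toggle_apply {S : Finset Q} {t : Q} (ht : t ∉ S) (x : Q → Fin 2) :
    toggle S t x = if ∀ i ∈ S, x i = 1 then update x t (x t + 1) else x := by
  have : (∀ i ∈ S, i ≠ t → x i = 1) ↔ ∀ i ∈ S, x i = 1 :=
    forall₂_congr fun i hi => ⟨fun h => h fun e => ht (e ▸ hi), fun h _ => h⟩
  simp only [toggle_apply_ite, this]

theorem toggle_inv (S : Finset Q) (t : Q) : (toggle S t)⁻¹ = toggle S t :=
  Function.Involutive.toPerm_symm _

variable [Fintype Q]

/-- The operator of a permutation of the computational basis. -/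
def permOp (σ : Equiv.Perm (Q → Fin 2)) : Operator Q :=
  Matrix.of fun x y => if x = σ y then 1 else 0

theorem permOp_mulVec (σ : Equiv.Perm (Q → Fin 2)) (ψ : (Q → Fin 2) → ℂ) (x : Q → Fin 2) :
    (permOp σ *ᵥ ψ) x = ψ (σ⁻¹ x) := by
  have h : ∀ y, x = σ y ↔ y = σ⁻¹ x := fun y => by
    rw [Equiv.Perm.eq_inv_iff_eq, eq_comm]
  simp [permOp, Matrix.mulVec, dotProduct, h]

theorem permOp_one : permOp (1 : Equiv.Perm (Q → Fin 2)) = 1 :=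
  operator_ext fun ψ x => by rw [permOp_mulVec, Matrix.one_mulVec]; rfl

theorem permOp_mul (σ τ : Equiv.Perm (Q → Fin 2)) : permOp (σ * τ) = permOp σ * permOp τ := by
  refine operator_ext fun ψ x => ?_
  rw [← Matrix.mulVec_mulVec, permOp_mulVec, permOp_mulVec, permOp_mulVec, _root_.mul_inv_rev]
  rfl

omit [DecidableEq Q] in
theorem permOp_conjTranspose (σ : Equiv.Perm (Q → Fin 2)) : (permOp σ)ᴴ = permOp σ⁻¹ := by
  ext x y
  have h : y = σ x ↔ x = σ⁻¹ y := by rw [Equiv.Perm.eq_inv_iff_eq, eq_comm]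
  simp only [permOp, Matrix.conjTranspose_apply, Matrix.of_apply, h]
  split_ifs <;> simp

theorem controlled_pauliX {S : Finset Q} {t : Q} (ht : t ∉ S) :
    controlled S t pauliX = permOp (toggle S t) := by
  refine operator_ext fun ψ x => ?_
  rw [controlled_mulVec ht, permOp_mulVec, toggle_inv, toggle_apply ht]
  split_ifs
  · generalize x t = b
    revert b
    rw [Fin.forall_fin_two]
    simp [pauliX]
  · rfl

/-- The diagonal operator with the phases `θ`. -/
noncomputable def phase (θ : (Q → Fin 2) → ℝ) : Operator Q :=
  Matrix.diagonal fun x => Complex.exp (Complex.I * θ x)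

theorem phase_mulVec (θ : (Q → Fin 2) → ℝ) (ψ : (Q → Fin 2) → ℂ) (x : Q → Fin 2) :
    (phase θ *ᵥ ψ) x = Complex.exp (Complex.I * θ x) * ψ x :=
  Matrix.mulVec_diagonal _ _ _

theorem phase_mul (θ φ : (Q → Fin 2) → ℝ) : phase θ * phase φ = phase (θ + φ) := by
  rw [phase, phase, Matrix.diagonal_mul_diagonal, phase]
  congr 1
  funext x
  rw [← Complex.exp_add, Pi.add_apply]
  push_cast
  ring_nf

omit [DecidableEq Q] in
theorem phase_zero : phase (0 : (Q → Fin 2) → ℝ) = 1 := by simp [phase]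

theorem permOp_conj_phase (σ : Equiv.Perm (Q → Fin 2)) (θ : (Q → Fin 2) → ℝ) :
    permOp σ⁻¹ * phase θ * permOp σ = phase (θ ∘ σ) := by
  refine operator_ext fun ψ x => ?_
  rw [← Matrix.mulVec_mulVec, ← Matrix.mulVec_mulVec, permOp_mulVec, phase_mulVec, permOp_mulVec,
    phase_mulVec]
  simp

/-- The phases of the gate which applies `diagPhase α β` to `t`, controlled by `S`. -/
noncomputable def ctrlAngle (S : Finset Q) (t : Q) (α β : ℝ) (x : Q → Fin 2) : ℝ :=
  if ∀ i ∈ S, x i = 1 then (if x t = 1 then β else α) else 0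

theorem controlled_diagPhase {S : Finset Q} {t : Q} (ht : t ∉ S) (α β : ℝ) :
    controlled S t (diagPhase α β) = phase (ctrlAngle S t α β) := by
  refine operator_ext fun ψ x => ?_
  rw [controlled_mulVec ht, phase_mulVec]
  unfold ctrlAngle
  split_ifs with h h'
  · conv_rhs => rw [← update_eq_self t x, h']
    simp [diagPhase, h']
  · have h0 : x t = 0 := by
      generalize x t = b at h'
      revert b; decide
    conv_rhs => rw [← update_eq_self t x, h0]
    simp [diagPhase, h0]
  · simp

theorem Implements.single (t : Q) (U : Matrix.unitaryGroup (Fin 2) ℂ) :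
    Implements {t} 1 (controlled ∅ t U.1) :=
  Implements.gate (.single t U)

theorem Implements.cnot {c t : Q} (h : c ≠ t) : Implements {c, t} 1 (permOp (toggle {c} t)) := by
  rw [← controlled_pauliX (by simpa using h.symm)]
  exact Implements.gate (.cnot c t h)

theorem Implements.phase_single (t : Q) (α β : ℝ) :
    Implements {t} 1 (phase (ctrlAngle ∅ t α β)) := by
  rw [← controlled_diagPhase (by simp)]
  exact Implements.single t ⟨_, diagPhase_mem α β⟩

theorem Implements.phase_add {A : Finset Q} {d e : ℕ} {θ φ : (Q → Fin 2) → ℝ}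
    (h : Implements A d (phase θ)) (h' : Implements A e (phase φ)) :
    Implements A (d + e) (phase (θ + φ)) := by
  rw [← phase_mul, add_comm d]; exact h.mul h'

theorem Implements.phase_comp {A : Finset Q} {d e : ℕ} {θ : (Q → Fin 2) → ℝ}
    {σ : Equiv.Perm (Q → Fin 2)} (h : Implements A d (phase θ)) (h' : Implements A e (permOp σ)) :
    Implements A (d + 2 * e) (phase (θ ∘ σ)) := by
  rw [← permOp_conj_phase]
  have h2 := h'.conjTranspose
  rw [permOp_conjTranspose] at h2
  exact ((h2.mul h).mul h').mono subset_rfl (by omega)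

theorem fin_two_ne_one {b : Fin 2} (h : b ≠ 1) : b = 0 := by
  revert b; decide

/-- With bits as integers, the angle is (α+β)/2 · x_c + (β−α)/2 · (x_t − (x_t ⊕ x_c)): three
one-qubit phases, the last conjugated by a CNOT. -/
theorem Implements.phase_ctrl {c t : Q} (h : c ≠ t) (α β : ℝ) :
    Implements {c, t} 5 (phase (ctrlAngle {c} t α β)) := by
  have h1 := (Implements.phase_single c 0 ((α + β) / 2)).mono (B := {c, t}) (by simp) le_rfl
  have h2 := (Implements.phase_single t 0 ((β - α) / 2)).mono (B := {c, t}) (by simp) le_rfl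
  have h3 := (Implements.phase_single t 0 (-((β - α) / 2))).mono (B := {c, t}) (by simp) le_rfl
  have h4 := (h1.phase_add h2).phase_add (h3.phase_comp (Implements.cnot h))
  convert h4 using 2
  funext x
  have ht : t ∉ ({c} : Finset Q) := by simpa using h.symm
  simp only [ctrlAngle, Pi.add_apply, Function.comp_apply, toggle_apply ht, Finset.mem_singleton,
    forall_eq, Finset.notMem_empty, false_imp_iff, implies_true, if_true]
  by_cases hc : x c = 1
  · by_cases hx : x t = 1
    · simp [hc, hx]; ring
    · have := fin_two_ne_one hx
      simp [hc, this]; ring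
  · by_cases hx : x t = 1
    · simp [hc, hx]
    · simp [hc, hx]

/-- Let s be the conjunction of the bits in S. The integer identity 2·s·x_c = x_c − (x_c ⊕ s) + s,
multiplied by half the angle selected by x_t, gives the three terms. -/
theorem ctrlAngle_insert {S : Finset Q} {c t : Q} (hc : c ∉ S) (hct : c ≠ t)
    (α β : ℝ) : ctrlAngle (insert c S) t α β =
      ctrlAngle {c} t (α / 2) (β / 2) + ctrlAngle {c} t (-(α / 2)) (-(β / 2)) ∘ toggle S c +
        ctrlAngle S t (α / 2) (β / 2) := by
  funext x
  simp only [ctrlAngle, Pi.add_apply, Function.comp_apply, toggle_apply hc, Finset.mem_singleton,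
    forall_eq, Finset.forall_mem_insert]
  by_cases hS : ∀ i ∈ S, x i = 1
  · rw [if_pos hS, if_pos hS]
    by_cases h1 : x c = 1
    · rw [if_pos ⟨h1, hS⟩, if_pos h1, update_self, h1,
        if_neg (by decide : ¬ (1 : Fin 2) + 1 = 1)]
      split_ifs <;> ring
    · rw [if_neg fun h => h1 h.1, if_neg h1, update_self, fin_two_ne_one h1,
        if_pos (by decide : (0 : Fin 2) + 1 = 1),
        update_of_ne hct.symm]
      split_ifs <;> ring
  · simp only [hS, and_false, if_false]
    split_ifs <;> simp

/-- One step of the recursion removing the control `c`. -/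
theorem Implements.phase_insert {A S : Finset Q} {c t : Q} (hct : c ≠ t)
    (hcA : c ∈ A) (htA : t ∈ A) (α β : ℝ) {d e : ℕ} {φ : (Q → Fin 2) → ℝ}
    (hd : Implements A d (permOp (toggle S c))) (he : Implements A e (phase φ)) :
    Implements A (e + (2 * d + 10))
      (phase (ctrlAngle {c} t (α / 2) (β / 2) +
        ctrlAngle {c} t (-(α / 2)) (-(β / 2)) ∘ toggle S c + φ)) := by
  have hs : ({c, t} : Finset Q) ⊆ A := by simp [Finset.insert_subset_iff, hcA, htA]
  have h1 := (Implements.phase_ctrl hct (α / 2) (β / 2)).mono hs le_rfl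
  have h2 := (Implements.phase_ctrl hct (-(α / 2)) (-(β / 2))).mono hs le_rfl
  exact ((h1.phase_add (h2.phase_comp hd)).phase_add he).mono subset_rfl (by omega)

theorem Implements.controlled_of_phase {A S : Finset Q} {t : Q} (ht : t ∉ S) (htA : t ∈ A)
    {d : ℕ} {W : Matrix.unitaryGroup (Fin 2) ℂ} {α β : ℝ}
    (h : Implements A d (phase (ctrlAngle S t α β))) :
    Implements A (d + 2) (controlled S t (W.1 * diagPhase α β * (W⁻¹).1)) := by
  have hW : W.1 * (W⁻¹).1 = 1 := congrArg Subtype.val (mul_inv_cancel W)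
  rw [← controlled_conj ht hW, controlled_diagPhase ht]
  have h1 := (Implements.single t W).mono (B := A) (by simpa using htA) le_rfl
  have h2 := (Implements.single t W⁻¹).mono (B := A) (by simpa using htA) le_rfl
  exact ((h1.mul h).mul h2).mono subset_rfl (by omega)

theorem pauliX_mem : pauliX ∈ Matrix.unitaryGroup (Fin 2) ℂ := by
  rw [Matrix.mem_unitaryGroup_iff', Matrix.star_eq_conjTranspose, pauliX_conjTranspose]
  ext i j; fin_cases i <;> fin_cases j <;> simp [pauliX]

theorem Implements.not (t : Q) : Implements {t} 1 (permOp (toggle ∅ t)) := by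
  rw [← controlled_pauliX (by simp)]
  exact Implements.single t ⟨_, pauliX_mem⟩

/-- One removal of a control already leaves only CNOTs and singly controlled phases, so no
approximation is needed. The depth is 5 + (2 + 10) for the phases and 2 for the change of basis. -/
theorem Implements.toffoli {a b t : Q} (hab : a ≠ b) (hat : a ≠ t) (hbt : b ≠ t) :
    Implements {a, b, t} 19 (permOp (toggle {a, b} t)) := by
  have ht : t ∉ ({a, b} : Finset Q) := by simp [hat.symm, hbt.symm]
  rw [← controlled_pauliX ht]
  obtain ⟨W, α, β, -, -, h⟩ := unitary_diagonalization ⟨_, pauliX_mem⟩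
  simp only at h
  rw [h]
  refine Implements.controlled_of_phase ht (by simp) ?_
  rw [ctrlAngle_insert (by simpa using hab) hat]
  exact Implements.phase_insert (d := 1) (e := 5) hat (by simp) (by simp) α β
    ((Implements.cnot hab.symm).mono (by intro i; simp; tauto) le_rfl)
    ((Implements.phase_ctrl hbt (α / 2) (β / 2)).mono (by intro i; simp; tauto) le_rfl)

end Permutations

end QuantumCircuit

namespace QuantumCircuit

open Function

/-! ### Multi-controlled NOT gates from Toffoli gates. -/

section Reversible

variable {Q : Type*} [DecidableEq Q]

/-- The permutation `σ` neither changes nor depends on the bits outside `A`. -/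
def ActsOn (A : Finset Q) (σ : Equiv.Perm (Q → Fin 2)) : Prop :=
  ∀ x i b, i ∉ A → σ (update x i b) = update (σ x) i b

theorem ActsOn.apply_eq {A : Finset Q} {σ : Equiv.Perm (Q → Fin 2)} (h : ActsOn A σ)
    (x : Q → Fin 2) {i : Q} (hi : i ∉ A) : σ x i = x i := by
  have := congrFun (h x i (x i) hi) i
  simpa using this

theorem ActsOn.mul {A : Finset Q} {σ τ : Equiv.Perm (Q → Fin 2)} (h : ActsOn A σ)
    (h' : ActsOn A τ) : ActsOn A (σ * τ) := fun x i b hi => by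
  rw [Equiv.Perm.mul_apply, h' x i b hi, h _ i b hi, Equiv.Perm.mul_apply]

theorem ActsOn.inv {A : Finset Q} {σ : Equiv.Perm (Q → Fin 2)} (h : ActsOn A σ) :
    ActsOn A σ⁻¹ := fun x i b hi => by
  rw [Equiv.Perm.inv_eq_iff_eq, h _ i b hi]
  exact congrArg (fun y => update y i b) (σ.apply_symm_apply x).symm

theorem ActsOn.mono {A B : Finset Q} {σ : Equiv.Perm (Q → Fin 2)} (h : ActsOn A σ)
    (hAB : A ⊆ B) : ActsOn B σ := fun x i b hi => h x i b fun h' => hi (hAB h')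

theorem actsOn_toggle {S : Finset Q} {t : Q} (ht : t ∉ S) : ActsOn (insert t S) (toggle S t) := by
  intro x i b hi
  rw [Finset.mem_insert, not_or] at hi
  have h : (∀ j ∈ S, update x i b j = 1) ↔ ∀ j ∈ S, x j = 1 :=
    forall₂_congr fun j hj => by
      have : j ≠ i := fun e => hi.2 (e ▸ hj)
      simp [this]
  simp only [toggle_apply ht, h]
  split_ifs
  · rw [update_of_ne (Ne.symm hi.1), update_comm hi.1]
  · rfl

theorem toggle_empty_apply (t : Q) (x : Q → Fin 2) (i : Q) :
    toggle ∅ t x i = if i = t then x i + 1 else x i := by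
  rw [toggle_apply (by simp)]
  by_cases h : i = t
  · subst h; simp
  · simp [h]

/-- Two toggles conditioned on a borrowed bit `a`, which may have either value. -/
theorem borrowed_toggle {p q : (Q → Fin 2) → Prop} [DecidablePred p] [DecidablePred q] {a t : Q}
    (hat : a ≠ t) {f g : (Q → Fin 2) → Q → Fin 2}
    (hf : ∀ x, f x = if p x ∧ x a = 1 then update x t (x t + 1) else x)
    (hg : ∀ x, g x = if q x then update x a (x a + 1) else x)
    (hpa : ∀ x b, p (update x a b) ↔ p x) (hpt : ∀ x b, p (update x t b) ↔ p x)
    (hqa : ∀ x b, q (update x a b) ↔ q x) (hqt : ∀ x b, q (update x t b) ↔ q x)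
    (x : Q → Fin 2) :
    (p x ∧ q x → g (f (g (f x))) = update x t (x t + 1)) ∧
      (¬ (p x ∧ q x) → g (f (g (f x))) = x) := by
  have h11 : (1 : Fin 2) + 1 ≠ 1 := by decide
  have h01 : (0 : Fin 2) + 1 = 1 := by decide
  -- If q holds, a has different values at the two calls of f, so exactly one of them sees a = 1,
  -- and the two calls of g restore a. If q fails, the two calls of f cancel.
  by_cases hp : p x <;> by_cases hq : q x
  · by_cases ha : x a = 1
    · simp [hf, hg, hp, hq, ha, hpa, hpt, hqa, hqt, hat]
    · have ha := fin_two_ne_one ha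
      simp [hf, hg, hp, hq, ha, hpa, hqa, hqt, hat, hat.symm]
      rw [update_comm hat, update_idem, ← ha, update_comm hat.symm, update_eq_self]
  · by_cases ha : x a = 1
    · simp [hf, hg, hp, hq, ha, hpt, hqt, hat, fin_two_add_one_add_one]
    · simp [hf, hg, hp, hq, ha]
  · simp [hf, hg, hp, hq, hpa, hqa, fin_two_add_one_add_one]
  · simp [hf, hg, hp, hq]

theorem forall_mem_update_iff {S : Finset Q} {t : Q} (ht : t ∉ S) (x : Q → Fin 2) (b : Fin 2) :
    (∀ i ∈ S, update x t b i = 1) ↔ ∀ i ∈ S, x i = 1 :=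
  forall₂_congr fun i hi => by
    have : i ≠ t := fun e => ht (e ▸ hi)
    simp [this]

variable [Fintype Q]

/-- The permutation `σ` acts on the bits in `A` and is implemented by a circuit of depth at most
`d` on `A`. -/
structure Realizes (A : Finset Q) (d : ℕ) (σ : Equiv.Perm (Q → Fin 2)) : Prop where
  actsOn : ActsOn A σ
  implements : Implements A d (permOp σ)

theorem Realizes.mono {A B : Finset Q} {d e : ℕ} {σ : Equiv.Perm (Q → Fin 2)}
    (h : Realizes A d σ) (hAB : A ⊆ B) (hde : d ≤ e) : Realizes B e σ :=
  ⟨h.1.mono hAB, h.2.mono hAB hde⟩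

theorem Realizes.one (A : Finset Q) (d : ℕ) : Realizes A d 1 :=
  ⟨fun _ _ _ _ => rfl, by rw [permOp_one]; exact Implements.one A d⟩

theorem Realizes.mul {A : Finset Q} {d e : ℕ} {σ τ : Equiv.Perm (Q → Fin 2)}
    (h : Realizes A d σ) (h' : Realizes A e τ) : Realizes A (e + d) (σ * τ) :=
  ⟨h.1.mul h'.1, by rw [permOp_mul]; exact h.2.mul h'.2⟩

theorem Realizes.inv {A : Finset Q} {d : ℕ} {σ : Equiv.Perm (Q → Fin 2)}
    (h : Realizes A d σ) : Realizes A d σ⁻¹ :=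
  ⟨h.1.inv, by rw [← permOp_conjTranspose]; exact h.2.conjTranspose⟩

theorem Realizes.parallel {A B : Finset Q} (hAB : Disjoint A B) {d : ℕ}
    {σ τ : Equiv.Perm (Q → Fin 2)} (h : Realizes A d σ) (h' : Realizes B d τ) :
    Realizes (A ∪ B) d (σ * τ) :=
  ⟨(h.1.mono Finset.subset_union_left).mul (h'.1.mono Finset.subset_union_right),
    by rw [permOp_mul]; exact h.2.parallel hAB h'.2⟩

theorem realizes_not (t : Q) : Realizes {t} 1 (toggle ∅ t) :=
  ⟨actsOn_toggle (Finset.notMem_empty t), Implements.not t⟩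

theorem realizes_toggle_of_card_le_two {S : Finset Q} {t : Q} (ht : t ∉ S) (hS : S.card ≤ 2) :
    Realizes (insert t S) 19 (toggle S t) := by
  refine ⟨actsOn_toggle ht, ?_⟩
  obtain h | h | h : S.card = 0 ∨ S.card = 1 ∨ S.card = 2 := by omega
  · rw [Finset.card_eq_zero] at h
    subst h
    exact (Implements.not t).mono (by rw [insert_empty_eq]) (by norm_num)
  · obtain ⟨c, rfl⟩ := Finset.card_eq_one.1 h
    have : c ≠ t := by simpa [eq_comm] using ht
    exact (Implements.cnot this).mono (by rw [Finset.pair_comm]) (by norm_num)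
  · obtain ⟨a, b, hab, rfl⟩ := Finset.card_eq_two.1 h
    simp only [Finset.mem_insert, Finset.mem_singleton, not_or] at ht
    exact (Implements.toffoli hab (Ne.symm ht.1) (Ne.symm ht.2)).mono
      (by intro i; simp; tauto) le_rfl

/-- A multi-controlled NOT gate in quadratic depth, with one borrowed bit `b`. -/
theorem realizes_toggle_quadratic (k : ℕ) : ∀ {A S : Finset Q} {t b : Q}, S.card ≤ 2 ^ k + 1 →
    t ∉ S → b ∉ S → b ≠ t → b ∈ A → t ∈ A → S ⊆ A → Realizes A (19 * 4 ^ k) (toggle S t) := by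
  induction k with
  | zero =>
    intro A S t b hS ht _ _ _ htA hSA
    exact (realizes_toggle_of_card_le_two ht hS).mono
      (Finset.insert_subset htA hSA) (by norm_num)
  | succ k ih =>
    intro A S t b hS ht hb hbt hbA htA hSA
    by_cases h2 : S.card ≤ 2
    · exact (realizes_toggle_of_card_le_two ht h2).mono (Finset.insert_subset htA hSA)
        (by have := Nat.one_le_pow (k + 1) 4 (by norm_num); omega)
    -- The bound 2^k + 1 reproduces itself: the smaller half gains the borrowed bit b as an extra
    -- control, and the larger half has at most 2^k + 1 elements.
    · obtain ⟨S₁, hS₁, hc₁⟩ := Finset.exists_subset_card_eq (Nat.div_le_self S.card 2)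
      have hc₂ : (S \ S₁).card = S.card - S.card / 2 := by
        rw [Finset.card_sdiff_of_subset hS₁, hc₁]
      have hb₁ : b ∉ S₁ := fun h => hb (hS₁ h)
      have ht₁ : t ∉ S₁ := fun h => ht (hS₁ h)
      have hb₂ : b ∉ S \ S₁ := fun h => hb (Finset.sdiff_subset h)
      have ht₂ : t ∉ S \ S₁ := fun h => ht (Finset.sdiff_subset h)
      rw [pow_succ] at hS
      obtain ⟨s, hs⟩ : (S \ S₁).Nonempty := Finset.card_pos.1 (by omega)
      have hsS : s ∈ S := Finset.sdiff_subset hs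
      have hs₁ : s ∉ S₁ := (Finset.mem_sdiff.1 hs).2
      have hsb : s ≠ b := fun e => hb (e ▸ hsS)
      have hst : s ≠ t := fun e => ht (e ▸ hsS)
      have htb₁ : t ∉ insert b S₁ := by simp [hbt.symm, ht₁]
      -- Each half borrows a bit idle in it: s from the other half here, and t for the second gate.
      have hf := ih (A := A) (S := insert b S₁) (t := t) (b := s)
        ((Finset.card_insert_le _ _).trans (by omega)) htb₁ (by simp [hsb, hs₁]) hst
        (hSA hsS) htA (Finset.insert_subset hbA (hS₁.trans hSA))
      have hg := ih (A := A) (S := S \ S₁) (t := b) (b := t) (by omega) hb₂ ht₂ hbt.symm htA hbA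
        (Finset.sdiff_subset.trans hSA)
      have key : toggle S t = toggle (S \ S₁) b * (toggle (insert b S₁) t *
          (toggle (S \ S₁) b * toggle (insert b S₁) t)) := by
        refine Equiv.ext fun x => ?_
        have := borrowed_toggle (p := fun x => ∀ i ∈ S₁, x i = 1)
          (q := fun x => ∀ i ∈ S \ S₁, x i = 1) hbt
          (f := toggle (insert b S₁) t) (g := toggle (S \ S₁) b)
          (fun x => by simp only [toggle_apply htb₁, Finset.forall_mem_insert, and_comm])
          (fun x => by convert toggle_apply hb₂ x) (forall_mem_update_iff hb₁) (forall_mem_update_iff ht₁)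
          (forall_mem_update_iff hb₂) (forall_mem_update_iff ht₂) x
        have hiff : (∀ i ∈ S, x i = 1) ↔ (∀ i ∈ S₁, x i = 1) ∧ ∀ i ∈ S \ S₁, x i = 1 := by
          refine ⟨fun h => ⟨fun i hi => h i (hS₁ hi),
            fun i hi => h i (Finset.sdiff_subset hi)⟩, fun h i hi => ?_⟩
          by_cases hi₁ : i ∈ S₁
          · exact h.1 i hi₁
          · exact h.2 i (Finset.mem_sdiff.2 ⟨hi, hi₁⟩)
        simp only [Equiv.Perm.mul_apply]
        rw [← hiff] at this
        rw [toggle_apply ht]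
        split_ifs with h
        · exact (this.1 h).symm
        · exact (this.2 h).symm
      rw [key]
      exact (hg.mul (hf.mul (hg.mul hf))).mono subset_rfl (by rw [pow_succ]; omega)

/-- A tree of Toffoli gates computing the conjunction of the bits in `Y` into the bit `r`, using
bits `Z` which are `0`. If the conjunction is true, then all other bits end up in the state `0`. -/
theorem exists_conjunction_tree (k : ℕ) : ∀ {Y Z : Finset Q}, Disjoint Y Z → Y.Nonempty →
    Y.card ≤ 2 ^ k → Y.card ≤ Z.card + 1 →
    ∃ (σ : Equiv.Perm (Q → Fin 2)) (r : Q), Realizes (Y ∪ Z) (21 * k) σ ∧ r ∈ Y ∪ Z ∧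
      ∀ x : Q → Fin 2, (∀ i ∈ Z, x i = 0) →
        ((∀ i ∈ Y, x i = 1) → ∀ i ∈ Y ∪ Z, σ x i = if i = r then 1 else 0) ∧
        ((¬ ∀ i ∈ Y, x i = 1) → σ x r = 0) := by
  have base : ∀ {Y Z : Finset Q} (d : ℕ), Y.card = 1 →
      ∃ (σ : Equiv.Perm (Q → Fin 2)) (r : Q), Realizes (Y ∪ Z) d σ ∧ r ∈ Y ∪ Z ∧
      ∀ x : Q → Fin 2, (∀ i ∈ Z, x i = 0) →
        ((∀ i ∈ Y, x i = 1) → ∀ i ∈ Y ∪ Z, σ x i = if i = r then 1 else 0) ∧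
        ((¬ ∀ i ∈ Y, x i = 1) → σ x r = 0) := by
    intro Y Z d hY
    obtain ⟨y, rfl⟩ := Finset.card_eq_one.1 hY
    refine ⟨1, y, Realizes.one _ _, by simp, fun x hx => ⟨fun h i hi => ?_, fun h => ?_⟩⟩
    · rw [Equiv.Perm.one_apply]
      split_ifs with e
      · exact e ▸ h y (by simp)
      · exact hx i (by simpa [e] using hi)
    · exact fin_two_ne_one (by simpa using h)
  induction k with
  | zero =>
    intro Y Z _ hne hY _
    exact base _ (le_antisymm (by simpa using hY) (Finset.card_pos.2 hne))
  | succ k ih =>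
    intro Y Z hYZ hne hY hZ
    by_cases h1 : Y.card = 1
    · exact base _ h1
    have hpos := Finset.card_pos.2 hne
    rw [pow_succ] at hY
    obtain ⟨Y₁, hY₁, hc₁⟩ := Finset.exists_subset_card_eq (Nat.div_le_self Y.card 2)
    set Y₂ := Y \ Y₁ with hY₂
    have hc₂ : Y₂.card = Y.card - Y.card / 2 := by rw [Finset.card_sdiff_of_subset hY₁, hc₁]
    obtain ⟨z, hz⟩ : Z.Nonempty := Finset.card_pos.1 (by omega)
    have hcz : (Z.erase z).card = Z.card - 1 := Finset.card_erase_of_mem hz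
    -- A tree with m leaves uses m − 1 zeroed bits. After z is reserved for the root and |Y₁| − 1
    -- bits for the first subtree, enough remain for the second.
    obtain ⟨Z₁, hZ₁, hcz₁⟩ := Finset.exists_subset_card_eq
      (show Y₁.card - 1 ≤ (Z.erase z).card by omega)
    set Z₂ := Z.erase z \ Z₁ with hZ₂
    have hcz₂ : Z₂.card = (Z.erase z).card - (Y₁.card - 1) := by
      rw [Finset.card_sdiff_of_subset hZ₁, hcz₁]
    have hdY : ∀ i ∈ Y, i ∉ Z := fun i hi => Finset.disjoint_left.1 hYZ hi
    have mY₁ : ∀ i ∈ Y₁, i ∈ Y := hY₁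
    have mY₂ : ∀ i, i ∈ Y₂ ↔ i ∈ Y ∧ i ∉ Y₁ := fun i => Finset.mem_sdiff
    have mZ₁ : ∀ i ∈ Z₁, i ∈ Z ∧ i ≠ z := fun i hi =>
      ⟨Finset.mem_of_mem_erase (hZ₁ hi), Finset.ne_of_mem_erase (hZ₁ hi)⟩
    have mZ₂ : ∀ i, i ∈ Z₂ ↔ (i ∈ Z ∧ i ≠ z) ∧ i ∉ Z₁ := fun i => by
      rw [hZ₂, Finset.mem_sdiff, Finset.mem_erase, and_comm (a := i ≠ z)]
    obtain ⟨σ₁, r₁, R₁, hr₁, P₁⟩ := ih (Y := Y₁) (Z := Z₁)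
      (Finset.disjoint_left.2 fun i hi hi' => hdY i (mY₁ i hi) (mZ₁ i hi').1)
      (Finset.card_pos.1 (by omega)) (by omega) (by omega)
    obtain ⟨σ₂, r₂, R₂, hr₂, P₂⟩ := ih (Y := Y₂) (Z := Z₂)
      (Finset.disjoint_left.2 fun i hi hi' => hdY i ((mY₂ i).1 hi).1 ((mZ₂ i).1 hi').1.1)
      (Finset.card_pos.1 (by omega)) (by omega) (by omega)
    have hd : ∀ i, i ∈ Y₁ ∪ Z₁ → i ∉ Y₂ ∪ Z₂ := by
      intro i hi hi'
      rw [Finset.mem_union] at hi hi'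
      have := mY₁ i; have := mY₂ i; have := mZ₁ i; have := mZ₂ i; have := hdY i
      tauto
    have hz₁ : z ∉ Y₁ ∪ Z₁ := by
      intro hi
      rw [Finset.mem_union] at hi
      have := mY₁ z; have := mZ₁ z; have := hdY z
      tauto
    have hz₂ : z ∉ Y₂ ∪ Z₂ := by
      intro hi
      rw [Finset.mem_union] at hi
      have := mY₂ z; have := mZ₂ z; have := hdY z
      tauto
    have hcover : ∀ i, i ∈ Y ∪ Z → i ∈ Y₁ ∪ Z₁ ∨ i ∈ Y₂ ∪ Z₂ ∨ i = z := by
      intro i hi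
      rw [Finset.mem_union] at hi ⊢
      rw [Finset.mem_union]
      have := mY₂ i; have := mZ₂ i
      tauto
    have hs₁ : Y₁ ∪ Z₁ ⊆ Y ∪ Z :=
      Finset.union_subset_union mY₁ fun i hi => (mZ₁ i hi).1
    have hs₂ : Y₂ ∪ Z₂ ⊆ Y ∪ Z :=
      Finset.union_subset_union (fun i hi => ((mY₂ i).1 hi).1) fun i hi => ((mZ₂ i).1 hi).1.1
    have hzYZ : z ∈ Y ∪ Z := Finset.mem_union_right _ hz
    have hr₁z : r₁ ≠ z := fun e => hz₁ (e ▸ hr₁)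
    have hr₂z : r₂ ≠ z := fun e => hz₂ (e ▸ hr₂)
    have hr₁₂ : r₁ ≠ r₂ := fun e => hd r₁ hr₁ (e ▸ hr₂)
    have hzr : z ∉ ({r₁, r₂} : Finset Q) := by simp [hr₁z.symm, hr₂z.symm]
    -- On success both subroots are 1, and the two NOTs clear them. On failure these NOTs may leave
    -- junk, but not in z. One level costs 19 + 1 + 1.
    refine ⟨toggle ∅ r₂ * (toggle ∅ r₁ * (toggle {r₁, r₂} z * (σ₁ * σ₂))), z, ?_, hzYZ, ?_⟩
    · have q₀ := (R₁.parallel (Finset.disjoint_left.2 fun i => hd i) R₂).mono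
        (Finset.union_subset hs₁ hs₂) le_rfl
      have q₁ := (realizes_toggle_of_card_le_two hzr Finset.card_le_two).mono (B := Y ∪ Z)
        (by simp [Finset.insert_subset_iff, hzYZ, hs₁ hr₁, hs₂ hr₂, -Finset.mem_union]) le_rfl
      have q₂ := (realizes_not r₁).mono (B := Y ∪ Z)
        (Finset.singleton_subset_iff.2 (hs₁ hr₁)) le_rfl
      have q₃ := (realizes_not r₂).mono (B := Y ∪ Z)
        (Finset.singleton_subset_iff.2 (hs₂ hr₂)) le_rfl
      exact (q₃.mul (q₂.mul (q₁.mul q₀))).mono subset_rfl (by omega)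
    · intro x hx
      have hx₂ : ∀ i ∈ Z₂, x i = 0 := fun i hi => hx i ((mZ₂ i).1 hi).1.1
      have e₁ : ∀ i ∈ Y₁ ∪ Z₁, σ₂ x i = x i := fun i hi => R₂.actsOn.apply_eq x (hd i hi)
      have hx₁ : ∀ i ∈ Z₁, σ₂ x i = 0 := fun i hi => by
        rw [e₁ i (Finset.mem_union_right _ hi)]; exact hx i (mZ₁ i hi).1
      have hy₁ : (∀ i ∈ Y₁, σ₂ x i = 1) ↔ ∀ i ∈ Y₁, x i = 1 :=
        forall₂_congr fun i hi => by rw [e₁ i (Finset.mem_union_left _ hi)]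
      obtain ⟨S₂, F₂⟩ := P₂ x hx₂
      obtain ⟨S₁, F₁⟩ := P₁ (σ₂ x) hx₁
      rw [hy₁] at S₁ F₁
      set u := σ₁ (σ₂ x) with hu
      have e₂ : ∀ i ∈ Y₂ ∪ Z₂, u i = σ₂ x i := fun i hi =>
        R₁.actsOn.apply_eq _ fun h => hd i h hi
      have ez : u z = 0 := by
        rw [hu, R₁.actsOn.apply_eq _ hz₁, R₂.actsOn.apply_eq _ hz₂, hx z hz]
      have hY : (∀ i ∈ Y, x i = 1) ↔ (∀ i ∈ Y₁, x i = 1) ∧ ∀ i ∈ Y₂, x i = 1 := by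
        refine ⟨fun h => ⟨fun i hi => h i (mY₁ i hi), fun i hi => h i ((mY₂ i).1 hi).1⟩,
          fun h i hi => ?_⟩
        by_cases hi₁ : i ∈ Y₁
        · exact h.1 i hi₁
        · exact h.2 i ((mY₂ i).2 ⟨hi, hi₁⟩)
      simp only [Equiv.Perm.mul_apply, ← hu, toggle_empty_apply, toggle_apply hzr,
        Finset.forall_mem_insert, Finset.mem_singleton, forall_eq]
      constructor
      · intro h
        rw [hY] at h
        have g₁ := S₁ h.1
        have g₂ := S₂ h.2
        have u₁ : u r₁ = 1 := by rw [g₁ r₁ hr₁, if_pos rfl]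
        have u₂ : u r₂ = 1 := by rw [e₂ r₂ hr₂, g₂ r₂ hr₂, if_pos rfl]
        rw [if_pos ⟨u₁, u₂⟩]
        intro i hi
        by_cases i₁ : i = r₁
        · subst i₁; simp [hr₁₂, hr₁z, u₁]
        by_cases i₂ : i = r₂
        · subst i₂; simp [hr₁₂.symm, hr₂z, u₂]
        by_cases iz : i = z
        · subst iz; simp [i₁, i₂, ez]
        rw [if_neg i₂, if_neg i₁, if_neg iz, update_of_ne iz]
        rcases hcover i hi with h' | h' | h'
        · rw [g₁ i h', if_neg i₁]
        · rw [e₂ i h', g₂ i h', if_neg i₂]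
        · exact absurd h' iz
      · intro h
        have hno : ¬ (u r₁ = 1 ∧ u r₂ = 1) := by
          rintro ⟨u₁, u₂⟩
          rw [e₂ r₂ hr₂] at u₂
          rw [hY, not_and_or] at h
          rcases h with h | h
          · rw [F₁ h] at u₁; exact absurd u₁ (by decide)
          · rw [F₂ h] at u₂; exact absurd u₂ (by decide)
        rw [if_neg hno, if_neg hr₂z.symm, if_neg hr₁z.symm, ez]

/-- The conjunction of the bits in `B` is reduced to the conjunction of few bits `G`. The bits
which have been processed serve, conditionally on success, as zeroed bits for the next ones. -/
theorem exists_conjunction_chunks (k j : ℕ) : ∀ {Z B : Finset Q}, Disjoint B Z → B.Nonempty →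
    2 ≤ Z.card → B.card ≤ 2 ^ k → B.card ≤ 2 ^ j * Z.card →
    ∃ (σ : Equiv.Perm (Q → Fin 2)) (G : Finset Q), Realizes (B ∪ Z) (21 * k * (j + 1)) σ ∧
      G ⊆ B ∪ Z ∧ G.card ≤ j + 1 ∧ (∃ e ∈ B ∪ Z, e ∉ G) ∧
      ∀ x : Q → Fin 2, (∀ i ∈ Z, x i = 0) → ((∀ i ∈ G, σ x i = 1) ↔ ∀ i ∈ B, x i = 1) := by
  have base : ∀ (d : ℕ) {Z B : Finset Q}, 21 * k ≤ d → Disjoint B Z → B.Nonempty →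
      2 ≤ Z.card → B.card ≤ 2 ^ k → B.card ≤ Z.card + 1 →
      ∃ (σ : Equiv.Perm (Q → Fin 2)) (G : Finset Q), Realizes (B ∪ Z) d σ ∧
        G ⊆ B ∪ Z ∧ G.card = 1 ∧ (∃ e ∈ B ∪ Z, e ∉ G) ∧
        ∀ x : Q → Fin 2, (∀ i ∈ Z, x i = 0) → ((∀ i ∈ G, σ x i = 1) ↔ ∀ i ∈ B, x i = 1) := by
    intro d Z B hd hBZ hne hZ hk hB
    obtain ⟨σ, r, R, hr, P⟩ := exists_conjunction_tree k hBZ hne hk hB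
    -- Two bits in Z guarantee one outside G, to be borrowed by the quadratic gate.
    have hc : 1 < (B ∪ Z).card := lt_of_lt_of_le hZ (Finset.card_le_card Finset.subset_union_right)
    obtain ⟨e, he, her⟩ := Finset.exists_mem_ne hc r
    refine ⟨σ, {r}, R.mono subset_rfl hd, by simpa using hr, by simp, ⟨e, he, by simpa using her⟩,
      fun x hx => ?_⟩
    obtain ⟨S, F⟩ := P x hx
    simp only [Finset.mem_singleton, forall_eq]
    constructor
    · intro h
      by_contra hcon
      rw [F hcon] at h
      exact absurd h (by decide)
    · intro h
      rw [S h r hr, if_pos rfl]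
  induction j with
  | zero =>
    intro Z B hBZ hne hZ hk hB
    obtain ⟨σ, G, h1, h2, h3, h4, h5⟩ := base (21 * k * (0 + 1)) (by simp) hBZ hne hZ hk
      (by omega)
    exact ⟨σ, G, h1, h2, by omega, h4, h5⟩
  | succ j ih =>
    intro Z B hBZ hne hZ hk hB
    have hdep : 21 * k * (j + 1 + 1) = 21 * k + 21 * k * (j + 1) := by ring
    by_cases hsmall : B.card ≤ Z.card + 1
    · obtain ⟨σ, G, h1, h2, h3, h4, h5⟩ := base (21 * k * (j + 1 + 1)) (by omega) hBZ hne hZ hk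
        hsmall
      exact ⟨σ, G, h1, h2, by omega, h4, h5⟩
    -- With |Z| + 1 leaves the tree occupies 2|Z| + 1 bits. All but the root are 0 on success, so
    -- the workspace doubles and j drops by one.
    obtain ⟨Y, hYB, hYc⟩ := Finset.exists_subset_card_eq (show Z.card + 1 ≤ B.card by omega)
    have hYZ : Disjoint Y Z := Finset.disjoint_of_subset_left hYB hBZ
    obtain ⟨σ, r, R, hr, P⟩ := exists_conjunction_tree k hYZ (Finset.card_pos.1 (by omega))
      ((Finset.card_le_card hYB).trans hk) hYc.le
    have hcB : (B \ Y).card = B.card - (Z.card + 1) := by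
      rw [Finset.card_sdiff_of_subset hYB, hYc]
    have hcZ : ((Y ∪ Z).erase r).card = 2 * Z.card := by
      rw [Finset.card_erase_of_mem hr, Finset.card_union_of_disjoint hYZ, hYc]; omega
    have hB' : ∀ i ∈ B \ Y, i ∉ Y ∪ Z := by
      intro i hi h
      rw [Finset.mem_sdiff] at hi
      rcases Finset.mem_union.1 h with h | h
      · exact hi.2 h
      · exact Finset.disjoint_left.1 hBZ hi.1 h
    obtain ⟨τ, G, T, hG, hGc, ⟨e, he, heG⟩, PG⟩ := ih (Z := (Y ∪ Z).erase r) (B := B \ Y)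
      (Finset.disjoint_left.2 fun i hi h => hB' i hi (Finset.mem_of_mem_erase h))
      (Finset.card_pos.1 (by omega)) (by omega) (by omega)
      (by rw [hcZ, hcB]; rw [pow_succ, mul_assoc] at hB; omega)
    have hrn : r ∉ B \ Y ∪ (Y ∪ Z).erase r := by
      intro h
      rcases Finset.mem_union.1 h with h | h
      · exact hB' r h hr
      · exact Finset.ne_of_mem_erase h rfl
    have hYZs : Y ∪ Z ⊆ B ∪ Z := Finset.union_subset_union hYB subset_rfl
    have hsub : B \ Y ∪ (Y ∪ Z).erase r ⊆ B ∪ Z :=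
      Finset.union_subset (Finset.sdiff_subset.trans Finset.subset_union_left)
        ((Finset.erase_subset _ _).trans hYZs)
    refine ⟨τ * σ, insert r G, ?_, Finset.insert_subset (hYZs hr) (hG.trans hsub),
      (Finset.card_insert_le _ _).trans (by omega), ⟨e, hsub he, ?_⟩, fun x hx => ?_⟩
    · exact ((T.mono hsub le_rfl).mul (R.mono hYZs le_rfl)).mono subset_rfl hdep.ge
    · rw [Finset.mem_insert, not_or]
      exact ⟨fun h => hrn (h ▸ he), heG⟩
    · obtain ⟨S, F⟩ := P x hx
      rw [Finset.forall_mem_insert, Equiv.Perm.mul_apply, T.actsOn.apply_eq _ hrn]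
      by_cases hY : ∀ i ∈ Y, x i = 1
      · have := PG (σ x) fun i hi => by
          rw [S hY i (Finset.mem_of_mem_erase hi), if_neg (Finset.ne_of_mem_erase hi)]
        rw [this, S hY r hr, if_pos rfl]
        simp only [true_and]
        constructor
        · intro h i hi
          by_cases hiY : i ∈ Y
          · exact hY i hiY
          · have hm : i ∈ B \ Y := Finset.mem_sdiff.2 ⟨hi, hiY⟩
            rw [← R.actsOn.apply_eq x (hB' i hm)]
            exact h i hm
        · intro h i hi
          rw [R.actsOn.apply_eq x (hB' i hi)]
          exact h i (Finset.sdiff_subset hi)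
      -- The root is 0 and `τ` does not touch it, so the failure stays visible in G whatever `τ`
      -- makes of the junk.
      · rw [F hY]
        refine iff_of_false (fun h => absurd h.1 (by decide)) fun h => hY fun i hi => h i (hYB hi)

/-- A multi-controlled NOT gate in polylogarithmic depth, with one borrowed bit `a`. -/
theorem realizes_toggle {A S : Finset Q} {t a : Q} {l : ℕ} (hS : S.card ≤ 2 ^ l) (ht : t ∉ S)
    (ha : a ∉ S) (hat : a ≠ t) (haA : a ∈ A) (htA : t ∈ A) (hSA : S ⊆ A) :
    Realizes A (300 * (l + 1) ^ 2) (toggle S t) := by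
  by_cases h2 : S.card ≤ 2
  · exact (realizes_toggle_of_card_le_two ht h2).mono (Finset.insert_subset htA hSA)
      (by have := Nat.one_le_pow 2 (l + 1) (by omega); omega)
  obtain ⟨Z, hZS, hZc⟩ := Finset.exists_subset_card_eq (show 2 ≤ S.card by omega)
  obtain ⟨y, z, hyz, rfl⟩ := Finset.card_eq_two.1 hZc
  have hcB : (S \ {y, z}).card = S.card - 2 := by
    rw [Finset.card_sdiff_of_subset hZS, hZc]
  have hyS : y ∈ S := hZS (by simp)
  have hzS : z ∈ S := hZS (by simp)
  obtain ⟨σ, G, R, hG, hGc, ⟨e, heS, heG⟩, P⟩ := exists_conjunction_chunks l l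
    (Z := {y, z}) (B := S \ {y, z}) Finset.sdiff_disjoint (Finset.card_pos.1 (by omega)) hZc.ge
    (by omega) (by rw [hZc]; omega)
  rw [Finset.sdiff_union_of_subset hZS] at R hG heS
  -- If y = z = 1, the NOTs supply the zeroed bits that `σ` expects. Otherwise `C` is meaningless,
  -- but then the toggle of a is idle and the two uses of the conjugated gate cancel.
  set C := σ * (toggle ∅ y * toggle ∅ z) with hC
  have RC : Realizes S (21 * l * (l + 1) + 2) C := by
    have q₁ := (realizes_not y).mono (B := S) (by simpa using hyS) le_rfl
    have q₂ := (realizes_not z).mono (B := S) (by simpa using hzS) le_rfl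
    exact (R.mul (q₁.mul q₂)).mono subset_rfl (by omega)
  have haG : a ∉ G := fun h => ha (hG h)
  have htG : t ∉ G := fun h => ht (hG h)
  have htaG : t ∉ insert a G := by simp [hat.symm, htG]
  -- G together with a has at most l + 2 ≤ 2^m + 1 elements, and 2^m ≤ 2(l + 1) keeps the cost 19 ·
  -- 4^m quadratic in l.
  set m := Nat.clog 2 (l + 1) with hm
  have hm1 : l + 1 ≤ 2 ^ m := Nat.le_pow_clog (by norm_num) _
  have hm2 : 2 ^ m ≤ 2 * (l + 1) := by
    rcases Nat.eq_zero_or_pos l with h0 | h0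
    · subst h0; simp [hm]
    · have h := (Nat.pow_pred_clog_lt_self (b := 2) (by norm_num) (x := l + 1) (by omega)).le
      have hmp : 0 < m := Nat.clog_pos (by norm_num) (by omega)
      obtain ⟨m', hm'⟩ : ∃ m', m = m' + 1 := ⟨m - 1, by omega⟩
      rw [← hm, hm'] at h
      simp only [Nat.pred_eq_sub_one, Nat.add_sub_cancel] at h
      rw [hm', pow_succ]; omega
  have hF : Realizes A (19 * 4 ^ m) (toggle (insert a G) t) :=
    realizes_toggle_quadratic m (b := e) ((Finset.card_insert_le _ _).trans (by omega)) htaG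
      (by simp only [Finset.mem_insert, not_or]; exact ⟨fun h => ha (h ▸ heS), heG⟩)
      (fun h => ht (h ▸ heS)) (hSA heS) htA (Finset.insert_subset haA (hG.trans hSA))
  have hayz : a ∉ ({y, z} : Finset Q) := fun h => ha (hZS h)
  have htyz : t ∉ ({y, z} : Finset Q) := fun h => ht (hZS h)
  have hg : Realizes A 19 (toggle {y, z} a) :=
    (realizes_toggle_of_card_le_two hayz Finset.card_le_two).mono
      (Finset.insert_subset haA (hZS.trans hSA)) le_rfl
  have RC' := RC.mono hSA le_rfl
  have hf := RC'.inv.mul (hF.mul RC')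
  have hCG : ∀ {s : Q}, s ∉ S → ∀ x b,
      (∀ i ∈ G, C (update x s b) i = 1) ↔ ∀ i ∈ G, C x i = 1 := fun {s} hs x b => by
    rw [RC.actsOn x s b hs]
    exact forall_mem_update_iff (fun h => hs (hG h)) _ _
  obtain ⟨F, hFdef⟩ : ∃ F, F = C⁻¹ * (toggle (insert a G) t * C) := ⟨_, rfl⟩
  rw [← hFdef] at hf
  have hFx : ∀ x, F x = if (∀ i ∈ G, C x i = 1) ∧ x a = 1 then update x t (x t + 1) else x := by
    intro x
    simp only [hFdef, Equiv.Perm.mul_apply, toggle_apply htaG, Finset.forall_mem_insert]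
    rw [RC.actsOn.apply_eq x ha, RC.actsOn.apply_eq x ht]
    simp only [and_comm (a := x a = 1)]
    split_ifs
    · rw [Equiv.Perm.inv_eq_iff_eq, RC.actsOn x t _ ht]
    · rw [Equiv.Perm.inv_eq_iff_eq]
  have hPx : ∀ x : Q → Fin 2, (∀ i ∈ ({y, z} : Finset Q), x i = 1) →
      ((∀ i ∈ G, C x i = 1) ↔ ∀ i ∈ S \ {y, z}, x i = 1) := by
    intro x h
    have h1 : x y = 1 := h y (by simp)
    have h2 : x z = 1 := h z (by simp)
    have h11 : (1 : Fin 2) + 1 = 0 := by decide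
    rw [hC, Equiv.Perm.mul_apply, P]
    · refine forall₂_congr fun i hi => ?_
      have : i ≠ y ∧ i ≠ z := by simpa using (Finset.mem_sdiff.1 hi).2
      simp only [Equiv.Perm.mul_apply, toggle_empty_apply, if_neg this.1, if_neg this.2]
    · simp [Equiv.Perm.mul_apply, toggle_empty_apply, hyz, hyz.symm, h1, h2, h11]
  have key : toggle S t = toggle {y, z} a * (F * (toggle {y, z} a * F)) := by
    refine Equiv.ext fun x => ?_
    have := borrowed_toggle (p := fun x => ∀ i ∈ G, C x i = 1)
      (q := fun x => ∀ i ∈ ({y, z} : Finset Q), x i = 1) hat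
      (f := F) (g := toggle {y, z} a) (fun x => by convert hFx x)
      (fun x => by convert toggle_apply hayz x) (hCG ha) (hCG ht)
      (forall_mem_update_iff hayz) (forall_mem_update_iff htyz) x
    have hiff : (∀ i ∈ S, x i = 1) ↔
        (∀ i ∈ G, C x i = 1) ∧ ∀ i ∈ ({y, z} : Finset Q), x i = 1 := by
      refine ⟨fun h => ?_, fun h i hi => ?_⟩
      · have hq : ∀ i ∈ ({y, z} : Finset Q), x i = 1 := fun i hi => h i (hZS hi)
        exact ⟨(hPx x hq).2 fun i hi => h i (Finset.sdiff_subset hi), hq⟩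
      · by_cases hi' : i ∈ ({y, z} : Finset Q)
        · exact h.2 i hi'
        · exact (hPx x h.2).1 h.1 i (Finset.mem_sdiff.2 ⟨hi, hi'⟩)
    simp only [Equiv.Perm.mul_apply]
    rw [← hiff] at this
    rw [toggle_apply ht]
    split_ifs with h
    · exact (this.1 h).symm
    · exact (this.2 h).symm
  rw [key]
  refine (hg.mul (hf.mul (hg.mul hf))).mono subset_rfl ?_
  have h4 : 4 ^ m ≤ 4 * (l + 1) ^ 2 := by
    calc 4 ^ m = (2 ^ m) ^ 2 := by rw [← pow_mul, mul_comm, pow_mul]; norm_num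
      _ ≤ (2 * (l + 1)) ^ 2 := Nat.pow_le_pow_left hm2 2
      _ = 4 * (l + 1) ^ 2 := by ring
  nlinarith

end Reversible

end QuantumCircuit

namespace QuantumCircuit

open Function

/-! ### Truncating the recursion and bounding the error. -/

section Approximation

variable {Q : Type*} [Fintype Q] [DecidableEq Q]

theorem abs_ctrlAngle_le (S : Finset Q) (t : Q) {α β r : ℝ} (hα : |α| ≤ r) (hβ : |β| ≤ r)
    (x : Q → Fin 2) : |ctrlAngle S t α β x| ≤ r := by
  unfold ctrlAngle
  split_ifs
  · exact hβ
  · exact hα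
  · simpa using (abs_nonneg α).trans hα

/-- Halving the angle `k` times approximates a multi-controlled diagonal gate. -/
theorem exists_phase_approximation {t : Q} (D : ℕ)
    (hD : ∀ (S : Finset Q) (c : Q), c ∉ S → t ∉ S → c ≠ t →
      Implements Finset.univ D (permOp (toggle S c))) (k : ℕ) :
    ∀ (S : Finset Q) (α β r : ℝ), t ∉ S → |α| ≤ r → |β| ≤ r →
      ∃ φ : (Q → Fin 2) → ℝ, Implements Finset.univ (1 + k * (2 * D + 10)) (phase φ) ∧
        ∀ x, |φ x - ctrlAngle S t α β x| ≤ r / 2 ^ k := by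
  induction k with
  | zero =>
    intro S α β r _ hα hβ
    refine ⟨0, by rw [phase_zero]; exact Implements.one _ _, fun x => ?_⟩
    simpa using abs_ctrlAngle_le S t hα hβ x
  | succ k ih =>
    intro S α β r ht hα hβ
    rcases S.eq_empty_or_nonempty with rfl | ⟨c, hc⟩
    -- If the controls run out early the result is exact; this final one-qubit phase accounts for
    -- the 1 in the depth.
    · refine ⟨ctrlAngle ∅ t α β, (Implements.phase_single t α β).mono (Finset.subset_univ _)
        (by omega), fun x => ?_⟩
      have : 0 ≤ r := (abs_nonneg α).trans hα
      simpa using by positivity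
    · have hct : c ≠ t := fun e => ht (e ▸ hc)
      have ht' : t ∉ S.erase c := fun h => ht (Finset.mem_of_mem_erase h)
      have half : ∀ a : ℝ, |a| ≤ r → |a / 2| ≤ r / 2 := fun a ha => by
        rw [abs_div, abs_two]; linarith
      obtain ⟨φ, hφ, hφ'⟩ := ih (S.erase c) (α / 2) (β / 2) (r / 2) ht' (half α hα) (half β hβ)
      refine ⟨_, (Implements.phase_insert (S := S.erase c) hct (Finset.mem_univ c)
        (Finset.mem_univ t) α β (hD _ c (Finset.notMem_erase c S) ht' hct) hφ).mono subset_rfl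
          (by rw [add_mul, one_mul, add_assoc]), fun x => ?_⟩
      -- The terms carrying the removed control are exact, so the only error is that of the
      -- recursive call on halved angles.
      have := hφ' x
      rw [div_div, ← pow_succ'] at this
      conv_lhs => rw [← Finset.insert_erase hc, ctrlAngle_insert (Finset.notMem_erase c S) hct]
      simpa using this

/-- The norm of a diagonal operator is its largest entry in modulus, and a chord of the unit circle
is no longer than its arc. -/
theorem norm_phase_sub_phase_le {θ φ : (Q → Fin 2) → ℝ} {r : ℝ} (hr : 0 ≤ r)
    (h : ∀ x, |θ x - φ x| ≤ r) : ‖phase θ - phase φ‖ ≤ r := by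
  rw [phase, phase, Matrix.diagonal_sub, Matrix.l2_opNorm_diagonal, pi_norm_le_iff_of_nonneg hr]
  intro x
  have e : Complex.exp (Complex.I * θ x) - Complex.exp (Complex.I * φ x) =
      Complex.exp (Complex.I * φ x) * (Complex.exp (Complex.I * (θ x - φ x : ℝ)) - 1) := by
    rw [mul_sub, ← Complex.exp_add, mul_one]
    congr 2
    push_cast
    ring
  rw [e, norm_mul, mul_comm Complex.I, Complex.norm_exp_ofReal_mul_I, one_mul]
  exact Real.norm_exp_I_mul_ofReal_sub_one_le.trans (h x)

theorem controlled_empty_mem_unitary (t : Q) (W : Matrix.unitaryGroup (Fin 2) ℂ) :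
    controlled ∅ t W.1 ∈ unitary (Operator Q) := by
  rw [Unitary.mem_iff, Matrix.star_eq_conjTranspose, controlled_conjTranspose (by simp),
    controlled_mul (by simp), controlled_mul (by simp), ← Matrix.star_eq_conjTranspose,
    Matrix.mem_unitaryGroup_iff.1 W.2, Matrix.mem_unitaryGroup_iff'.1 W.2]
  exact ⟨controlled_one (by simp), controlled_one (by simp)⟩

theorem exists_controlled_approximation {t : Q} (D : ℕ)
    (hD : ∀ (S : Finset Q) (c : Q), c ∉ S → t ∉ S → c ≠ t →
      Implements Finset.univ D (permOp (toggle S c))) (k : ℕ) {S : Finset Q} (ht : t ∉ S)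
    (U : Matrix.unitaryGroup (Fin 2) ℂ) :
    ∃ M : Operator Q, Implements Finset.univ (3 + k * (2 * D + 10)) M ∧
      ‖M - controlled S t U.1‖ ≤ Real.pi / 2 ^ k := by
  obtain ⟨W, α, β, hα, hβ, hU⟩ := unitary_diagonalization U
  obtain ⟨φ, hφ, hφ'⟩ := exists_phase_approximation D hD k S α β Real.pi ht hα hβ
  have hW : W.1 * (W⁻¹).1 = 1 := congrArg Subtype.val (mul_inv_cancel W)
  have h1 := (Implements.single t W).mono (Finset.subset_univ _) le_rfl
  have h2 := (Implements.single t W⁻¹).mono (Finset.subset_univ _) le_rfl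
  refine ⟨_, ((h1.mul hφ).mul h2).mono subset_rfl (by omega), ?_⟩
  rw [hU, ← controlled_conj ht hW, controlled_diagPhase ht, ← sub_mul, ← mul_sub,
    CStarRing.norm_mul_mem_unitary _ (controlled_empty_mem_unitary t W⁻¹),
    CStarRing.norm_mem_unitary_mul _ (controlled_empty_mem_unitary t W)]
  exact norm_phase_sub_phase_le (by positivity) hφ'

end Approximation

theorem exists_circuit_multiControlled (n k : ℕ) (U : Matrix.unitaryGroup (Fin 2) ℂ) :
    ∃ c : Circuit (Fin (n + 1)), ‖c.toOperator - multiControlled n U.1‖ ≤ Real.pi / 2 ^ k ∧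
      c.depth ≤ 3 + k * (600 * (Nat.log 2 n + 2) ^ 2 + 10) := by
  have hD : ∀ (S : Finset (Fin (n + 1))) (c : Fin (n + 1)), c ∉ S → Fin.last n ∉ S →
      c ≠ Fin.last n →
      Implements Finset.univ (300 * (Nat.log 2 n + 1 + 1) ^ 2) (permOp (toggle S c)) := by
    intro S c hc ht hct
    -- The target qubit is idle in a NOT among the controls, so it serves as the borrowed bit.
    refine (realizes_toggle (a := Fin.last n) ?_ hc ht hct.symm (Finset.mem_univ _)
      (Finset.mem_univ _) (Finset.subset_univ _)).implements
    have h1 : S.card ≤ n := by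
      have := Finset.card_le_card (Finset.subset_univ (insert (Fin.last n) S))
      rw [Finset.card_insert_of_notMem ht, Finset.card_univ, Fintype.card_fin] at this
      omega
    exact h1.trans (Nat.lt_pow_succ_log_self (by norm_num) n).le
  obtain ⟨M, ⟨l, -, hl, rfl⟩, hM⟩ := exists_controlled_approximation _ hD k
    (Finset.notMem_erase (Fin.last n) Finset.univ) U
  exact ⟨⟨l⟩, hM, hl.trans (le_of_eq (by ring))⟩

/-! ### Choice of the constants. -/

theorem log_add_two_le {n : ℕ} (hn : 2 ≤ n) :
    ((Nat.log 2 n : ℝ) + 2) ≤ 3 / Real.log 2 * Real.log n := by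
  have h2 : 0 < Real.log 2 := Real.log_pos (by norm_num)
  have h1 : (1 : ℝ) ≤ Nat.log 2 n := by
    exact_mod_cast Nat.log_pos (by norm_num) hn
  have h3 : (Nat.log 2 n : ℝ) * Real.log 2 ≤ Real.log n := by
    rw [← Real.log_pow]
    refine Real.log_le_log (by positivity) ?_
    exact_mod_cast Nat.pow_log_le_self 2 (by omega)
  rw [div_mul_eq_mul_div, le_div_iff₀ h2]
  nlinarith

end QuantumCircuit

theorem theorem3 :
    ∃ K : ℝ, 0 < K ∧
      ∀ n : ℕ, 2 ≤ n →
        ∀ ε : ℝ, 0 < ε → ε ≤ 1 / 2 →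
          ∀ U : Matrix.unitaryGroup (Fin 2) ℂ,
            ∃ c : QuantumCircuit.Circuit (Fin (n + 1)),
              ‖c.toOperator - QuantumCircuit.multiControlled n U.1‖ ≤ ε ∧
              (c.depth : ℝ) ≤ K * Real.log (n : ℝ) ^ (2.799 : ℝ) * Real.log (1 / ε) := by
  have h2 : 0 < Real.log 2 := Real.log_pos (by norm_num)
  set K₀ : ℝ := Real.log 2 ^ (-0.799 : ℝ) with hK₀
  have hK₀pos : 0 < K₀ := Real.rpow_pos_of_pos h2 _
  -- Here 613 = 3 + 600 + 10 absorbs the lower-order depth terms, 3/log 2 comes from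
  -- `log_add_two_le`, `K₀` pays for raising the exponent from 2 to 2.799, and 4/log 2 comes from k
  -- ≤ 4 log₂(1/ε).
  refine ⟨613 * (3 / Real.log 2) ^ 2 * K₀ * (4 / Real.log 2), by positivity, ?_⟩
  intro n hn ε hε hε2 U
  have hn2 : (2 : ℝ) ≤ n := by exact_mod_cast hn
  set X : ℝ := Real.log (1 / ε) / Real.log 2 with hX
  have hX1 : 1 ≤ X := by
    rw [hX, le_div_iff₀ h2, one_mul]
    -- The hypothesis ε ≤ 1/2 enters here.
    refine Real.log_le_log (by norm_num) ?_
    rw [le_div_iff₀ hε]; linarith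
  -- The two extra halvings compensate π ≤ 4 = 2².
  set k : ℕ := ⌈X + 2⌉₊ with hk
  have hk1 : X + 2 ≤ k := Nat.le_ceil _
  have hk2 : (k : ℝ) ≤ 4 * X := by
    have := (Nat.ceil_lt_add_one (show 0 ≤ X + 2 by linarith)).le
    linarith
  obtain ⟨c, hc, hd⟩ := QuantumCircuit.exists_circuit_multiControlled n k U
  refine ⟨c, hc.trans ?_, ?_⟩
  · have hpow : 4 / ε ≤ (2 : ℝ) ^ k := by
      rw [← Real.log_le_log_iff (by positivity) (by positivity), Real.log_pow]
      have e : Real.log (4 / ε) = (X + 2) * Real.log 2 := by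
        rw [add_mul, hX, div_mul_cancel₀ _ h2.ne', show 4 / ε = 1 / ε * 2 ^ 2 by ring,
          Real.log_mul (by positivity) (by positivity), Real.log_pow]
        norm_num
      rw [e]
      exact mul_le_mul_of_nonneg_right hk1 h2.le
    rw [div_le_iff₀ (by positivity)]
    rw [div_le_iff₀ hε] at hpow
    linarith [Real.pi_le_four]
  · set L : ℝ := Real.log n with hL
    have hLl : Real.log 2 ≤ L := Real.log_le_log (by norm_num) hn2
    have hLpos : 0 < L := h2.trans_le hLl
    have hpowL : L ^ 2 ≤ K₀ * L ^ (2.799 : ℝ) := by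
      have e : L ^ (2.799 : ℝ) = L ^ 2 * L ^ (0.799 : ℝ) := by
        rw [← Real.rpow_natCast, ← Real.rpow_add hLpos]; norm_num
      have h3 : Real.log 2 ^ (0.799 : ℝ) ≤ L ^ (0.799 : ℝ) :=
        Real.rpow_le_rpow h2.le hLl (by norm_num)
      have h4 : K₀ * Real.log 2 ^ (0.799 : ℝ) = 1 := by
        rw [hK₀, ← Real.rpow_add h2]; norm_num
      have h5 : 1 ≤ K₀ * L ^ (0.799 : ℝ) := by
        rw [← h4]; exact mul_le_mul_of_nonneg_left h3 hK₀pos.le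
      rw [e]
      nlinarith [sq_nonneg L]
    set a : ℝ := (Nat.log 2 n : ℝ) + 2 with ha
    have ha1 : 1 ≤ a := by
      have : (0 : ℝ) ≤ Nat.log 2 n := by positivity
      rw [ha]
      linarith
    have haL : a ≤ 3 / Real.log 2 * L := QuantumCircuit.log_add_two_le hn
    have ha2 : a ^ 2 ≤ (3 / Real.log 2) ^ 2 * L ^ 2 := by
      rw [← mul_pow]; exact pow_le_pow_left₀ (by linarith) haL 2
    have hd' : (c.depth : ℝ) ≤ 3 + k * (600 * a ^ 2 + 10) := by
      rw [ha]; exact_mod_cast hd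
    have hk0 : (1 : ℝ) ≤ k := by linarith
    calc (c.depth : ℝ) ≤ 3 + k * (600 * a ^ 2 + 10) := hd'
      _ ≤ k * (613 * a ^ 2) := by nlinarith [one_le_pow₀ ha1 (n := 2)]
      _ ≤ (4 * X) * (613 * ((3 / Real.log 2) ^ 2 * (K₀ * L ^ (2.799 : ℝ)))) := by
        gcongr
        exact ha2.trans (mul_le_mul_of_nonneg_left hpowL (by positivity))
      _ = _ := by rw [hX]; ring
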